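/- Model. An algorithm with shared memory runs a sequence of steps; step $i$ performs $w_i$ constant-time operations in parallel (Common-CRCW PRAM: concurrent writes to a cell must write equal values). Its work is $\sum_i w_i$, its span is the number of steps. RC-trees. Let $F$ be a forest on $n$ vertices with maximum degree at most a constant $\Delta$. A tree contraction of $F$ proceeds in rounds. In each round a set of pairwise non-adjacent vertices of the current forest contracts: a vertex with one neighbour rakes, a vertex with two neighbours compresses (its two edges are replaced by one edge between its neighbours), and an isolated vertex finalizes. Initially the clusters are the edges of $F$, with their endpoints as boundary vertices. When $v$ contracts, the vertex $v$ and all present clusters with $v$ as a boundary vertex are merged into the cluster represented by $v$, whose boundary vertices are those of the merged clusters, minus $v$. The RC-tree is the resulting tree of clusters (one tree for each component of $F$). It is stored with parents, children, boundary vertices, the contraction history (the rounds in which vertices contract and the list of live vertices of each round) and, for each cluster, the total weight of the vertices and edges in it. For a constant $\beta<1$, the RC-tree is balanced if at every round at most a $\beta$-fraction of the live vertices survives; a randomized RC-tree is balanced if at every round the expected number of surviving vertices is at most $\beta$ times the expected number of live vertices. Queries. The vertices and edges of $F$ carry weights from a commutative semigroup. A subtree query $(u,p)$, with $u$ and $p$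 adjacent in $F$, asks for the sum of the weights of all vertices and edges of the subtree rooted at $u$ when $p$ is its parent, i.e. of the component of $u$ in $F$ minus the edge $\{u,p\}$. Theorem. For every $\Delta$ there is an algorithm which, for every $\beta<1$, answers any batch of $k\ge 1$ distinct subtree queries on any stored balanced RC-tree over any commutative semigroup, leaving the stored tree intact, in $O\left(k\log\left(1+\frac nk\right)\right)$ work and $O(\log n)$ span, where the implied constants depend only on $\Delta$ and $\beta$. If the RC-tree is randomized (and the batch is fixed independently of the randomness), the answers are always correct, the work bound holds in expectation, and the span is $O(\log n)$ with high probability: for a constant $C=C(\Delta,\beta)$ and every $a>0$, the span exceeds $C(a+1)\log n$ with probability at most $n^{-a}$. If queries may be repeated in the batch, the same holds with (expected) work $O\left(k+k\log\left(1+\frac nk\right)\right)$. -/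

import Mathlib

open scoped NNReal ENNReal

/-! ### Rake-compress trees -/

/-- The nodes of an RC-tree of the forest `G`: `Sum.inl v` is the internal cluster represented by
the vertex `v`, and `Sum.inr e` is the base cluster of the edge `e`. (The base cluster of a vertex
`v`, always a child of `Sum.inl v`, is left implicit.) -/
abbrev RCNode {n : ℕ} (G : SimpleGraph (Fin n)) : Type := Fin n ⊕ G.edgeSet

/-- The first round at whose start a cluster exists, when the vertex `v` contracts in round
`round v`. -/
def RCNode.formed {n : ℕ} {G : SimpleGraph (Fin n)} (round : Fin n → ℕ) : RCNode G → ℕ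
  | Sum.inl v => round v + 1
  | Sum.inr _ => 0

/-- The cluster `c` is present at the start of round `i`: it has been formed, and none of its
boundary vertices has contracted yet (it is merged when its first boundary vertex contracts). -/
def RCNode.LiveAt {n : ℕ} {G : SimpleGraph (Fin n)} (round : Fin n → ℕ)
    (boundary : RCNode G → Finset (Fin n)) (c : RCNode G) (i : ℕ) : Prop :=
  c.formed round ≤ i ∧ ∀ x ∈ boundary c, i ≤ round x

/-- The clusters that are merged when `v` contracts: those present in that round which have `v`
as a boundary vertex. -/
def RCNode.IsChild {n : ℕ} {G : SimpleGraph (Fin n)} (round : Fin n → ℕ)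
    (boundary : RCNode G → Finset (Fin n)) (c : RCNode G) (v : Fin n) : Prop :=
  v ∈ boundary c ∧ c.LiveAt round boundary (round v)

/-- An RC-tree (one tree for each component) of the forest `G`, that is, a tree contraction of `G`
with the recursive clustering it induces. In round `i` the vertices `v` with `round v = i`
contract; `v` rakes, compresses or finalizes according to whether it then has one, two or no
neighbours, and the neighbours are the boundary vertices of the cluster that is formed. -/
structure RCTree {n : ℕ} (G : SimpleGraph (Fin n)) where
  /-- the round in which a vertex contracts -/
  round : Fin n → ℕ
  /-- the boundary vertices of a cluster -/
  boundary : RCNode G → Finset (Fin n)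
  /-- the boundary vertices of a base edge cluster are the two endpoints -/
  mem_boundary_edge : ∀ (e : G.edgeSet) (x : Fin n),
    x ∈ boundary (Sum.inr e) ↔ x ∈ (e : Sym2 (Fin n))
  /-- the boundary of the cluster represented by `v` is the union of the boundaries of the merged
  clusters, minus `v` -/
  mem_boundary_vertex : ∀ v x : Fin n, x ∈ boundary (Sum.inl v) ↔
    x ≠ v ∧ ∃ c : RCNode G, c.IsChild round boundary v ∧ x ∈ boundary c
  /-- the vertices that contract in one round are pairwise non-adjacent in the contracted forest,
  whose edges are the binary clusters present in that round -/
  independent : ∀ (i : ℕ) (c : RCNode G), c.LiveAt round boundary i →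
    ∀ x ∈ boundary c, ∀ y ∈ boundary c, round x = i → round y = i → x = y
  /-- only vertices with at most two neighbours contract -/
  card_boundary_le : ∀ v : Fin n, (boundary (Sum.inl v)).card ≤ 2

namespace RCTree

/-- `c` is a child of the node represented by `v`. -/
def IsChild {n : ℕ} {G : SimpleGraph (Fin n)} (R : RCTree G) (c : RCNode G) (v : Fin n) : Prop :=
  RCNode.IsChild R.round R.boundary c v

/-- `c` is `d` or a descendant of `d` in the RC-tree. For `c` a vertex `x` (as `Sum.inl x`) or an
edge, this says that the vertex or edge belongs to the contents of the cluster `d`. -/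
def Below {n : ℕ} {G : SimpleGraph (Fin n)} (R : RCTree G) : RCNode G → RCNode G → Prop :=
  Relation.ReflTransGen fun c d => ∃ v : Fin n, d = Sum.inl v ∧ R.IsChild c v

/-- The vertices that have not contracted before round `i`. -/
def live {n : ℕ} {G : SimpleGraph (Fin n)} (R : RCTree G) (i : ℕ) : Finset (Fin n) :=
  Finset.univ.filter fun v => i ≤ R.round v

/-- The number of rounds after which all vertices have contracted. -/
def rounds {n : ℕ} {G : SimpleGraph (Fin n)} (R : RCTree G) : ℕ :=
  Finset.univ.sup fun v => R.round v + 1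

end RCTree

/-! ### Weights and subtree queries

Vertices and edges carry weights `w : RCNode G → S` in a commutative semigroup `S` (`w (Sum.inl v)`
for a vertex, `w (Sum.inr e)` for an edge). A finite sum of weights is taken in `WithZero S`, which
is `S` with an empty sum `0` adjoined; a non-empty sum is the sum in `S`. -/

/-- The sum of the weights over a set of vertices and edges. -/
noncomputable def weightSum {n : ℕ} {G : SimpleGraph (Fin n)} {S : Type*} [AddCommSemigroup S]
    (w : RCNode G → S) (A : Set (RCNode G)) : WithZero S :=
  ∑ᶠ y ∈ A, ((w y : S) : WithZero S)

/-- The vertices of the subtree rooted at `u` when its neighbour `p` is the parent of `u`. -/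
def subtreeVertices {n : ℕ} (G : SimpleGraph (Fin n)) (u p : Fin n) : Set (Fin n) :=
  {x | (G.deleteEdges {s(u, p)}).Reachable u x}

/-- The subtree rooted at `u` with respect to the parent `p`: its vertices, and the edges between
them. -/
def subtree {n : ℕ} (G : SimpleGraph (Fin n)) (u p : Fin n) : Set (RCNode G) :=
  {y | match y with
    | Sum.inl x => x ∈ subtreeVertices G u p
    | Sum.inr e => ∀ x ∈ (e : Sym2 (Fin n)), x ∈ subtreeVertices G u p}

/-! ### Parallel programs with work and span (Common-CRCW PRAM) -/

namespace PRAM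

/-- The shared memory: arrays of words and arrays of semigroup cells. `word a i` is cell `i` of the
word array `a`, and `elt a i` is cell `i` of the semigroup array `a` (`0` is an empty cell). -/
structure Mem (S : Type*) where
  word : ℕ → ℕ → ℕ
  elt : ℕ → ℕ → WithZero S

/-- Word expressions, evaluated by one processor. There is no multiplication, so that a constant
number of operations enlarges words by a constant number of bits only. -/
inductive WExp : Type
  /-- a numeral -/
  | const (c : ℕ)
  /-- the index of the processor -/
  | pid
  /-- a memory access -/
  | get (a : ℕ) (addr : WExp)
  /-- sum -/
  | add (x y : WExp)
  /-- difference, cut off at 0 -/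
  | sub (x y : WExp)
  /-- `x` if `c` is not 0, else `y` -/
  | ite (c x y : WExp)

/-- Value of a word expression for the processor with index `p`. -/
def WExp.eval {S : Type*} (M : Mem S) (p : ℕ) : WExp → ℕ
  | .const c => c
  | .pid => p
  | .get a addr => M.word a (addr.eval M p)
  | .add x y => x.eval M p + y.eval M p
  | .sub x y => x.eval M p - y.eval M p
  | .ite c x y => if c.eval M p ≠ 0 then x.eval M p else y.eval M p

/-- Semigroup expressions; the semigroup is used only through its operation. -/
inductive EExp : Type
  /-- the empty cell -/
  | empty
  /-- a memory access -/
  | get (a : ℕ) (addr : WExp)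
  /-- the semigroup operation -/
  | add (x y : EExp)
  /-- `x` if `c` is not 0, else `y` -/
  | ite (c : WExp) (x y : EExp)

/-- Value of a semigroup expression for the processor with index `p`. -/
def EExp.eval {S : Type*} [AddCommSemigroup S] (M : Mem S) (p : ℕ) : EExp → WithZero S
  | .empty => 0
  | .get a addr => M.elt a (addr.eval M p)
  | .add x y => x.eval M p + y.eval M p
  | .ite c x y => if c.eval M p ≠ 0 then x.eval M p else y.eval M p

/-- A write to a cell, performed if `guard` is not 0. -/
inductive Write : Type
  | word (guard : WExp) (a : ℕ) (addr val : WExp)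
  | elt (guard : WExp) (a : ℕ) (addr : WExp) (val : EExp)

/-- Processor `p`, executing the operation `b`, writes `x` to cell `i` of the word array `a`. -/
def WritesWord {S : Type*} (M : Mem S) (b : List Write) (p a i x : ℕ) : Prop :=
  ∃ guard addr val, Write.word guard a addr val ∈ b ∧ guard.eval M p ≠ 0 ∧
    addr.eval M p = i ∧ val.eval M p = x

/-- Processor `p`, executing the operation `b`, writes `x` to cell `i` of the semigroup array
`a`. -/
def WritesElt {S : Type*} [AddCommSemigroup S] (M : Mem S) (b : List Write) (p a i : ℕ)
    (x : WithZero S) : Prop :=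
  ∃ guard addr val, Write.elt guard a addr val ∈ b ∧ guard.eval M p ≠ 0 ∧
    addr.eval M p = i ∧ val.eval M p = x

/-- One synchronous step, which turns the memory `M` into `M'`: the processors `0, …, N - 1` all
read `M`, then write. Concurrent writes to one cell must write the same value, otherwise there is
no `M'` and the computation is invalid. -/
structure Step {S : Type*} [AddCommSemigroup S] (M : Mem S) (N : ℕ) (b : List Write) (M' : Mem S) :
    Prop where
  word_write : ∀ p < N, ∀ a i x, WritesWord M b p a i x → M'.word a i = x
  word_keep : ∀ a i, (∀ p < N, ∀ x, ¬ WritesWord M b p a i x) → M'.word a i = M.word a i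
  elt_write : ∀ p < N, ∀ a i x, WritesElt M b p a i x → M'.elt a i = x
  elt_keep : ∀ a i, (∀ p < N, ∀ x, ¬ WritesElt M b p a i x) → M'.elt a i = M.elt a i

/-- Parallel programs. A program is a finite text, so each `b` in it is a constant-time
operation of a processor. -/
inductive Prog : Type
  /-- one step, with as many processors as the value of `N` says, each executing `b` -/
  | par (N : WExp) (b : List Write)
  /-- sequential composition -/
  | seq (P Q : Prog)
  /-- while the value of `c` is not 0 do `P` -/
  | loop (c : WExp) (P : Prog)

/-- `Exec P M M' W T`: started on the memory `M`, the program `P` halts with the memory `M'`, with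
work `W` and span `T`. A step with `N` processors has work `N + 1` (the unit is for issuing the
step) and span `1`; each test of a loop condition has work and span `1`. -/
inductive Exec {S : Type*} [AddCommSemigroup S] : Prog → Mem S → Mem S → ℕ → ℕ → Prop
  | par {N : WExp} {b : List Write} {M M' : Mem S} :
      Step M (N.eval M 0) b M' → Exec (.par N b) M M' (N.eval M 0 + 1) 1
  | seq {P Q : Prog} {M₁ M₂ M₃ : Mem S} {W₁ W₂ T₁ T₂ : ℕ} :
      Exec P M₁ M₂ W₁ T₁ → Exec Q M₂ M₃ W₂ T₂ → Exec (.seq P Q) M₁ M₃ (W₁ + W₂) (T₁ + T₂)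
  | loop_stop {c : WExp} {P : Prog} {M : Mem S} :
      c.eval M 0 = 0 → Exec (.loop c P) M M 1 1
  | loop_next {c : WExp} {P : Prog} {M₁ M₂ M₃ : Mem S} {W₁ W₂ T₁ T₂ : ℕ} :
      c.eval M₁ 0 ≠ 0 → Exec P M₁ M₂ W₁ T₁ → Exec (.loop c P) M₂ M₃ W₂ T₂ →
        Exec (.loop c P) M₁ M₃ (W₁ + W₂ + 1) (T₁ + T₂ + 1)

end PRAM

/-! ### The RC-tree in memory -/

/-- The cells `f 0, …, f (L - 1)` list the elements of `A`, each once; an element `a` is stored as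
`a + 1`, and the remaining cells hold `0` (null). -/
def Slots (f : ℕ → ℕ) (L : ℕ) (A : Set ℕ) : Prop :=
  (∀ j < L, f j = 0 ∨ ∃ a ∈ A, f j = a + 1) ∧ ∀ a ∈ A, ∃! j, j < L ∧ f j = a + 1

/-- The number of a node: vertex clusters are numbered by their representatives, and the base edge
clusters follow. -/
def RCNode.code {n m : ℕ} {G : SimpleGraph (Fin n)} (E : G.edgeSet ≃ Fin m) : RCNode G → ℕ
  | Sum.inl v => v
  | Sum.inr e => n + E e

/-- The memory `M` holds the RC-tree `R` of a forest with maximum degree at most `D`, augmented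
with the total weight of each cluster, together with the batch `q` of queries. Cells that are not
mentioned have arbitrary contents. -/
structure Holds {n m k : ℕ} {G : SimpleGraph (Fin n)} {S : Type*} [AddCommSemigroup S] (D : ℕ)
    (E : G.edgeSet ≃ Fin m) (R : RCTree G) (w : RCNode G → S) (q : Fin k → Fin n × Fin n)
    (M : PRAM.Mem S) : Prop where
  /-- the number of vertices -/
  card_vertices : M.word 0 0 = n
  /-- the number of queries -/
  card_queries : M.word 0 1 = k
  /-- the queries `(u, p)` -/
  query_root : ∀ j : Fin k, M.word 1 j = (q j).1
  query_parent : ∀ j : Fin k, M.word 2 j = (q j).2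
  /-- the round in which a vertex contracts -/
  round : ∀ v : Fin n, M.word 3 v = R.round v
  /-- the parent of a node -/
  parent : ∀ c : RCNode G,
    Slots (fun _ => M.word 4 (c.code E)) 1 {x | ∃ v : Fin n, R.IsChild c v ∧ x = v}
  /-- the boundary vertices of a node -/
  boundary : ∀ c : RCNode G,
    Slots (fun j => M.word (5 + j) (c.code E)) 2 {x | ∃ v ∈ R.boundary c, x = (v : ℕ)}
  /-- the contraction history: for each round, the vertices that are live in it -/
  live_card : ∀ i ≤ R.rounds, M.word 7 i = (R.live i).card
  live_list : ∀ i ≤ R.rounds, Set.BijOn (fun j => M.word 9 (M.word 8 i + j))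
    {j | j < (R.live i).card} {x | ∃ v ∈ R.live i, x = (v : ℕ)}
  /-- the children of an internal node -/
  children : ∀ v : Fin n,
    Slots (fun j => M.word (10 + j) v) D {x | ∃ c : RCNode G, R.IsChild c v ∧ x = c.code E}
  /-- the augmented values: the total weight of the contents of each cluster -/
  total : ∀ c : RCNode G, M.elt 0 (c.code E) = weightSum w {y | R.Below y c}
  /-- the weights of the vertices themselves -/
  weight : ∀ v : Fin n, M.elt 1 v = ((w (Sum.inl v) : S) : WithZero S)

/-- A run of the program `P` on `M` with work `W` and span `T` that answers all queries: the answer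
to query `j` is delivered in cell `j` of the semigroup array `2`, and the stored RC-tree is left
intact. -/
def AnswersQueries {n m k : ℕ} {G : SimpleGraph (Fin n)} {S : Type*} [AddCommSemigroup S] (D : ℕ)
    (E : G.edgeSet ≃ Fin m) (R : RCTree G) (w : RCNode G → S) (q : Fin k → Fin n × Fin n)
    (P : PRAM.Prog) (M : PRAM.Mem S) (W T : ℕ) : Prop :=
  ∃ M' : PRAM.Mem S, PRAM.Exec P M M' W T ∧ Holds D E R w q M' ∧
    ∀ j : Fin k, M'.elt 2 j = weightSum w (subtree G (q j).1 (q j).2)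

/-!
The program stores no paths. For a subtree query `(u, p)` let `A` be the subtree, with its vertices
and edges. Climbing from the base cluster of the edge `{u, p}` to the root, every cluster `c` on the
way has `A` cut only inside it (`RCTree.CutInside`): an edge outside `c` belongs to `A` if and only
if its end points do. As the contents of a cluster are connected (`RCTree.mem_iff_of_connected`),
every sibling of `c` lies with its boundary on the side of the common parent, inside `A` or outside.
So two bits, which say which boundary vertices of `c` belong to `A`, determine the corresponding
bits for the parent (`Holds.bitsMatch_parent`) and the weight that the parent adds to the weight of
the part of `A` inside `c` (`Holds.gain_eq`), each by a constant number of operations. For the same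
reason the weight of the part of `A` outside `c` depends only on `c` and the two bits, and can be
tabulated from the root downwards (`Holds.outsideValue_eq`).

If all `k` queries climbed to the root, the work would be `k` for each round. This is wasteful once
fewer than `k` vertices are live. Let `i₀` be the first round with at most `k` live vertices. The
program `PRAM.queryProg` tabulates the outside weights of all clusters formed from round `i₀` on, at
the cost of one processor for each live vertex in each of these rounds, and lets the queries climb
for `i₀` rounds only. With `Lᵢ` live vertices in round `i`, the work is `O(k + ∑ᵢ min k Lᵢ)` and the
span is proportional to the number of rounds (`Holds.exists_run_queryProg`).

If the tree is balanced in expectation, then `E Lᵢ ≤ βⁱ n`, hence `E (min k Lᵢ) ≤ min k (βⁱ n)`, and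
the sum of these is `O(k + k log (1 + n / k))` (`tsum_min_pow_mul_le`); the tail bound for the number
of rounds is Markov's inequality for `Lᵢ` (`measure_rounds_le`). A graph of maximum degree `D` has
at most `D n` distinct queries, so that `k = O(k log (1 + n / k))` if the queries are distinct. A
deterministic RC-tree is a randomized one with a single outcome.
-/

/-! ### The structure of an RC-tree -/

namespace RCTree

variable {n : ℕ} {G : SimpleGraph (Fin n)} (R : RCTree G)

theorem round_lt_of_mem_boundary {v x : Fin n} (h : x ∈ R.boundary (Sum.inl v)) :
    R.round v < R.round x := by
  obtain ⟨hne, c, hc, hx⟩ := (R.mem_boundary_vertex v x).1 h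
  refine lt_of_le_of_ne (hc.2.2 x hx) fun heq => hne ?_
  exact R.independent _ c hc.2 x hx v hc.1 heq.symm rfl

theorem formed_le_of_mem_boundary {c : RCNode G} {x : Fin n} (h : x ∈ R.boundary c) :
    c.formed R.round ≤ R.round x := by
  cases c with
  | inl v => exact R.round_lt_of_mem_boundary h
  | inr e => exact Nat.zero_le _

variable {R}

/-- A cluster that is not a root has a parent: the boundary vertex that contracts first. -/
theorem exists_isChild_of_boundary_nonempty {c : RCNode G} (h : (R.boundary c).Nonempty) :
    ∃ v, R.IsChild c v := by
  obtain ⟨v, hv, hmin⟩ := Finset.exists_min_image (R.boundary c) R.round h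
  exact ⟨v, hv, R.formed_le_of_mem_boundary hv, hmin⟩

theorem IsChild.unique {c : RCNode G} {v v' : Fin n} (h : R.IsChild c v) (h' : R.IsChild c v') :
    v = v' := by
  have h1 := h.2.2 v' h'.1
  have h2 := h'.2.2 v h.1
  exact R.independent _ c h.2 v h.1 v' h'.1 rfl (le_antisymm h2 h1)

theorem IsChild.formed_lt {c : RCNode G} {v : Fin n} (h : R.IsChild c v) :
    c.formed R.round < RCNode.formed R.round (Sum.inl v : RCNode G) :=
  Nat.lt_succ_of_le h.2.1

theorem IsChild.below {c : RCNode G} {v : Fin n} (h : R.IsChild c v) : R.Below c (Sum.inl v) :=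
  Relation.ReflTransGen.single ⟨v, rfl, h⟩

theorem Below.formed_le {c d : RCNode G} (h : R.Below c d) :
    c.formed R.round ≤ d.formed R.round := by
  induction h with
  | refl => exact le_rfl
  | tail _ hcd ih =>
    obtain ⟨v, rfl, hc⟩ := hcd
    exact ih.trans hc.formed_lt.le

theorem below_vertex_iff {y : RCNode G} {v : Fin n} :
    R.Below y (Sum.inl v) ↔ y = Sum.inl v ∨ ∃ c, R.IsChild c v ∧ R.Below y c := by
  constructor
  · intro h
    rcases Relation.ReflTransGen.cases_tail h with h | ⟨c, hyc, u, hu, hc⟩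
    · exact Or.inl h.symm
    · cases hu
      exact Or.inr ⟨c, hc, hyc⟩
  · rintro (rfl | ⟨c, hc, hyc⟩)
    · exact Relation.ReflTransGen.refl
    · exact hyc.trans hc.below

theorem below_edge_iff {y : RCNode G} {e : G.edgeSet} :
    R.Below y (Sum.inr e) ↔ y = Sum.inr e := by
  constructor
  · intro h
    rcases Relation.ReflTransGen.cases_tail h with h | ⟨c, hyc, u, hu, hc⟩
    · exact h.symm
    · cases hu
  · rintro rfl
    exact Relation.ReflTransGen.refl

/-- The ancestors of a cluster form a chain. -/
theorem Below.total {y c d : RCNode G} (hc : R.Below y c) (hd : R.Below y d) :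
    R.Below c d ∨ R.Below d c := by
  refine Relation.ReflTransGen.total_of_right_unique ?_ hc hd
  rintro a b b' ⟨v, rfl, hv⟩ ⟨v', rfl, hv'⟩
  rw [hv.unique hv']

/-- A strict ancestor of `c` lies above the parent of `c`. -/
theorem Below.eq_or_above_parent {c r : RCNode G} {v : Fin n} (h : R.Below c r)
    (hc : R.IsChild c v) : r = c ∨ R.Below (Sum.inl v) r := by
  rcases Relation.ReflTransGen.cases_head h with h | ⟨b, ⟨u, rfl, hu⟩, hbr⟩
  · exact Or.inl h.symm
  · rw [hc.unique hu]
    exact Or.inr hbr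

theorem Below.eq_of_boundary_eq_empty {c r : RCNode G} (h : R.Below c r)
    (hc : R.boundary c = ∅) : r = c := by
  rcases Relation.ReflTransGen.cases_head h with h | ⟨b, ⟨u, rfl, hu⟩, hbr⟩
  · exact h.symm
  · have := hu.1
    simp [hc] at this

/-- Distinct children of a node have disjoint contents. -/
theorem IsChild.eq_of_below {c d y : RCNode G} {v : Fin n} (hc : R.IsChild c v)
    (hd : R.IsChild d v) (hyc : R.Below y c) (hyd : R.Below y d) : c = d := by
  have key : ∀ {c d : RCNode G}, R.IsChild c v → R.IsChild d v → R.Below c d → c = d := by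
    intro c d hc hd h
    rcases h.eq_or_above_parent hc with h | h
    · exact h.symm
    · have h1 := h.formed_le
      have h2 := hd.formed_lt
      omega
  rcases hyc.total hyd with h | h
  · exact key hc hd h
  · exact (key hd hc h).symm

theorem IsChild.not_below_self {c : RCNode G} {v : Fin n} (hc : R.IsChild c v) :
    ¬ R.Below (Sum.inl v) c := fun h => by
  have h1 := h.formed_le
  have h2 := hc.formed_lt
  omega

/-- Every cluster has an ancestor without boundary, the root of its tree. -/
theorem exists_root (R : RCTree G) (c : RCNode G) :
    ∃ r, R.Below c r ∧ R.boundary r = ∅ := by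
  induction hN : R.rounds - c.formed R.round using Nat.strong_induction_on generalizing c with
  | _ N ih =>
    rcases (R.boundary c).eq_empty_or_nonempty with h | h
    · exact ⟨c, Relation.ReflTransGen.refl, h⟩
    · obtain ⟨v, hv⟩ := exists_isChild_of_boundary_nonempty h
      have h1 := hv.formed_lt
      have h2 : RCNode.formed R.round (Sum.inl v : RCNode G) ≤ R.rounds :=
        Finset.le_sup (f := fun v => R.round v + 1) (Finset.mem_univ v)
      obtain ⟨r, hr, hr'⟩ := ih _ (by omega) (Sum.inl v) rfl
      exact ⟨r, hv.below.trans hr, hr'⟩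

/-- The end points of an edge in the contents of `c` are boundary vertices of `c` or belong to the
contents of `c`. -/
theorem Below.mem_boundary_or_below {e : G.edgeSet} {c : RCNode G} (h : R.Below (Sum.inr e) c)
    {x : Fin n} (hx : x ∈ (e : Sym2 (Fin n))) : x ∈ R.boundary c ∨ R.Below (Sum.inl x) c := by
  induction h with
  | refl => exact Or.inl ((R.mem_boundary_edge e x).2 hx)
  | @tail c d _ hcd ih =>
    obtain ⟨v, rfl, hc⟩ := hcd
    rcases ih with h | h
    · by_cases hxv : x = v
      · subst hxv
        exact Or.inr Relation.ReflTransGen.refl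
      · exact Or.inl ((R.mem_boundary_vertex v x).2 ⟨hxv, c, hc, h⟩)
    · exact Or.inr (h.trans hc.below)

/-- The contents of a cluster are connected: a set that contains an edge of the cluster if it
contains one of its end points, and conversely, contains everything in the cluster and on its
boundary, or nothing. -/
theorem mem_iff_of_connected {A : Set (RCNode G)} {d : RCNode G}
    (hA : ∀ f : G.edgeSet, R.Below (Sum.inr f) d → ∀ x ∈ (f : Sym2 (Fin n)),
      (Sum.inl x ∈ A ↔ Sum.inr f ∈ A)) {b : Fin n} (hb : b ∈ R.boundary d) {y : RCNode G}
    (hy : R.Below y d ∨ ∃ x ∈ R.boundary d, y = Sum.inl x) : y ∈ A ↔ Sum.inl b ∈ A := by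
  induction hN : d.formed R.round using Nat.strong_induction_on generalizing d b y with
  | _ N ih =>
    subst hN
    cases d with
    | inr e =>
      have hb' := hA e Relation.ReflTransGen.refl b ((R.mem_boundary_edge e b).1 hb)
      rcases hy with hy | ⟨x, hx, rfl⟩
      · rw [below_edge_iff.1 hy, hb']
      · rw [hA e Relation.ReflTransGen.refl x ((R.mem_boundary_edge e x).1 hx), hb']
    | inl v =>
      have child : ∀ c, R.IsChild c v → ∀ y, (R.Below y c ∨ ∃ x ∈ R.boundary c, y = Sum.inl x) →
          (y ∈ A ↔ Sum.inl v ∈ A) := fun c hc y hy =>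
        ih _ hc.formed_lt (fun f hf => hA f (hf.trans hc.below)) hc.1 hy rfl
      obtain ⟨-, c, hc, hbc⟩ := (R.mem_boundary_vertex v b).1 hb
      rw [child c hc (Sum.inl b) (Or.inr ⟨b, hbc, rfl⟩)]
      rcases hy with hy | ⟨x, hx, rfl⟩
      · rcases below_vertex_iff.1 hy with rfl | ⟨c, hc, hyc⟩
        · rfl
        · exact child c hc y (Or.inl hyc)
      · obtain ⟨-, c, hc, hxc⟩ := (R.mem_boundary_vertex v x).1 hx
        exact child c hc _ (Or.inr ⟨x, hxc, rfl⟩)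

/-! ### Sets of vertices and edges that are cut only inside a cluster -/

/-- The set `A` of vertices and edges lies in the component of the cluster `c`, and every edge
between `A` and its complement belongs to the contents of `c`. -/
structure CutInside (R : RCTree G) (A : Set (RCNode G)) (c : RCNode G) : Prop where
  mem_iff : ∀ f : G.edgeSet, ¬ R.Below (Sum.inr f) c → ∀ x ∈ (f : Sym2 (Fin n)),
    (Sum.inl x ∈ A ↔ Sum.inr f ∈ A)
  exists_common : ∀ y ∈ A, ∃ r, R.Below c r ∧ R.Below y r

theorem CutInside.parent {A : Set (RCNode G)} {c : RCNode G} {v : Fin n} (h : R.CutInside A c)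
    (hc : R.IsChild c v) : R.CutInside A (Sum.inl v) where
  mem_iff f hf x hx := h.mem_iff f (fun hfc => hf (hfc.trans hc.below)) x hx
  exists_common y hy := by
    obtain ⟨r, hcr, hyr⟩ := h.exists_common y hy
    rcases hcr.eq_or_above_parent hc with rfl | h'
    · exact ⟨_, Relation.ReflTransGen.refl, hyr.trans hc.below⟩
    · exact ⟨r, h', hyr⟩

theorem CutInside.subset_of_root {A : Set (RCNode G)} {c : RCNode G} (h : R.CutInside A c)
    (hc : R.boundary c = ∅) : A ⊆ {y | R.Below y c} := fun y hy => by
  obtain ⟨r, hcr, hyr⟩ := h.exists_common y hy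
  rwa [hcr.eq_of_boundary_eq_empty hc] at hyr

/-- A sibling of a cluster `c` lies, with its boundary, on one side of a cut inside `c`: the side
of the common parent. -/
theorem CutInside.sibling {A : Set (RCNode G)} {c d : RCNode G} {v : Fin n} (h : R.CutInside A c)
    (hc : R.IsChild c v) (hd : R.IsChild d v) (hne : d ≠ c) {y : RCNode G}
    (hy : R.Below y d ∨ ∃ x ∈ R.boundary d, y = Sum.inl x) : y ∈ A ↔ Sum.inl v ∈ A :=
  mem_iff_of_connected
    (fun f hf => h.mem_iff f fun hfc => hne (hd.eq_of_below hc hf hfc)) hd.1 hy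

theorem CutInside.mem_boundary_parent {A : Set (RCNode G)} {c : RCNode G} {v : Fin n}
    (h : R.CutInside A c) (hc : R.IsChild c v) {b : Fin n} (hb : b ∈ R.boundary (Sum.inl v))
    (hbc : b ∉ R.boundary c) : Sum.inl b ∈ A ↔ Sum.inl v ∈ A := by
  obtain ⟨-, d, hd, hbd⟩ := (R.mem_boundary_vertex v b).1 hb
  exact h.sibling hc hd (fun hdc => hbc (hdc ▸ hbd)) (Or.inr ⟨b, hbd, rfl⟩)

/-- What the parent of `c` adds to a set that is cut inside `c`. -/
theorem CutInside.inter_diff_eq {A : Set (RCNode G)} {c : RCNode G} {v : Fin n}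
    (h : R.CutInside A c) (hc : R.IsChild c v) (hv : Sum.inl v ∈ A) :
    A ∩ ({y | R.Below y (Sum.inl v)} \ {y | R.Below y c}) =
      {Sum.inl v} ∪ ⋃ d ∈ {d | R.IsChild d v ∧ d ≠ c}, {y | R.Below y d} := by
  ext y
  simp only [Set.mem_inter_iff, Set.mem_sdiff, Set.mem_ofPred_eq, Set.mem_union,
    Set.mem_singleton_iff, Set.mem_iUnion, exists_prop]
  constructor
  · rintro ⟨-, hyv, hyc⟩
    rcases below_vertex_iff.1 hyv with rfl | ⟨d, hd, hyd⟩
    · exact Or.inl rfl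
    · exact Or.inr ⟨d, ⟨hd, fun hdc => hyc (hdc ▸ hyd)⟩, hyd⟩
  · rintro (rfl | ⟨d, ⟨hd, hne⟩, hyd⟩)
    · exact ⟨hv, Relation.ReflTransGen.refl, hc.not_below_self⟩
    · exact ⟨(h.sibling hc hd hne (Or.inl hyd)).2 hv, hyd.trans hd.below,
        fun hyc => hne (hd.eq_of_below hc hyd hyc)⟩

theorem CutInside.inter_diff_eq_empty {A : Set (RCNode G)} {c : RCNode G} {v : Fin n}
    (h : R.CutInside A c) (hc : R.IsChild c v) (hv : Sum.inl v ∉ A) :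
    A ∩ ({y | R.Below y (Sum.inl v)} \ {y | R.Below y c}) = ∅ := by
  rw [Set.eq_empty_iff_forall_notMem]
  rintro y ⟨hyA, hyv, hyc⟩
  rcases below_vertex_iff.1 hyv with rfl | ⟨d, hd, hyd⟩
  · exact hv hyA
  · exact hv ((h.sibling hc hd (fun hdc => hyc (hdc ▸ hyd)) (Or.inl hyd)).1 hyA)

end RCTree

/-! ### The subtree of a query -/

section Subtree

variable {n : ℕ} {G : SimpleGraph (Fin n)}

theorem inr_mem_subtree_iff {u p x : Fin n} {f : G.edgeSet} (hf : (f : Sym2 (Fin n)) ≠ s(u, p))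
    (hx : x ∈ (f : Sym2 (Fin n))) :
    (Sum.inl x : RCNode G) ∈ subtree G u p ↔ (Sum.inr f : RCNode G) ∈ subtree G u p := by
  refine ⟨fun h y hy => ?_, fun h => h x hx⟩
  obtain ⟨f, hfG⟩ := f
  obtain ⟨z, rfl⟩ := hx
  have hxz : (G.deleteEdges {s(u, p)}).Adj x z := by
    rw [SimpleGraph.deleteEdges_adj]
    exact ⟨hfG, hf⟩
  have hx' : (G.deleteEdges {s(u, p)}).Reachable u x := h
  rcases Sym2.mem_iff.1 hy with rfl | rfl
  · exact hx'
  · exact hx'.trans hxz.reachable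

theorem parent_notMem_subtree (hG : G.IsAcyclic) {u p : Fin n} (h : G.Adj u p) :
    (Sum.inl p : RCNode G) ∉ subtree G u p :=
  SimpleGraph.isBridge_iff.1 (SimpleGraph.isAcyclic_iff_forall_adj_isBridge.1 hG h)

theorem cutInside_subtree (R : RCTree G) {u p : Fin n} (e : G.edgeSet)
    (he : (e : Sym2 (Fin n)) = s(u, p)) : R.CutInside (subtree G u p) (Sum.inr e) := by
  refine ⟨fun f hf x hx => inr_mem_subtree_iff (fun h => hf ?_) hx, ?_⟩
  · rw [Subtype.ext (h.trans he.symm)]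
    exact Relation.ReflTransGen.refl
  obtain ⟨r, her, hr⟩ := R.exists_root (Sum.inr e)
  have hend : ∀ {f : G.edgeSet} {r : RCNode G}, R.Below (Sum.inr f) r → R.boundary r = ∅ →
      ∀ x ∈ (f : Sym2 (Fin n)), R.Below (Sum.inl x) r := fun hf hr x hx => by
    simpa [hr] using hf.mem_boundary_or_below hx
  have hedge : ∀ (f : G.edgeSet), ∀ x ∈ (f : Sym2 (Fin n)), R.Below (Sum.inl x) r →
      R.Below (Sum.inr f) r := fun f x hx hxr => by
    obtain ⟨r', hfr', hr'⟩ := R.exists_root (Sum.inr f)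
    rcases hxr.total (hend hfr' hr' x hx) with h | h
    · rwa [← h.eq_of_boundary_eq_empty hr]
    · rwa [h.eq_of_boundary_eq_empty hr']
  have hvert : ∀ x, G.Reachable u x → R.Below (Sum.inl x) r := by
    rintro x ⟨walk⟩
    have hu : R.Below (Sum.inl u) r := hend her hr u (by rw [he]; exact Sym2.mem_mk_left u p)
    clear he
    induction walk with
    | nil => exact hu
    | @cons a b _ hab _ ih =>
      exact ih (hend (hedge ⟨s(a, b), hab⟩ a (Sym2.mem_mk_left a b) hu) hr b
        (Sym2.mem_mk_right a b))
  have hmono : ∀ x ∈ subtreeVertices G u p, R.Below (Sum.inl x) r := fun x hx =>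
    hvert x (SimpleGraph.Reachable.mono (SimpleGraph.deleteEdges_le _) hx)
  rintro (x | f) hy
  · exact ⟨r, her, hmono x hy⟩
  · exact ⟨r, her, hedge f _ f.1.out_fst_mem (hmono _ (hy _ f.1.out_fst_mem))⟩

end Subtree

/-! ### Sums of weights -/

section WeightSum

variable {n : ℕ} {G : SimpleGraph (Fin n)} {S : Type*} [AddCommSemigroup S] (w : RCNode G → S)

theorem weightSum_empty : weightSum w ∅ = 0 := finsum_mem_empty

theorem weightSum_singleton (y : RCNode G) : weightSum w {y} = ((w y : S) : WithZero S) :=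
  finsum_mem_singleton

theorem weightSum_union {A B : Set (RCNode G)} (h : Disjoint A B) :
    weightSum w (A ∪ B) = weightSum w A + weightSum w B :=
  finsum_mem_union h (Set.toFinite _) (Set.toFinite _)

open scoped Classical in
theorem weightSum_biUnion {ι : Type*} [Fintype ι] (I : Set ι) (t : ι → Set (RCNode G))
    (h : I.PairwiseDisjoint t) :
    weightSum w (⋃ i ∈ I, t i) = ∑ i : ι, if i ∈ I then weightSum w (t i) else 0 := by
  rw [weightSum, finsum_mem_biUnion h (Set.toFinite _) fun _ _ => Set.toFinite _,
    finsum_mem_eq_finite_toFinset_sum _ (Set.toFinite I), ← Finset.sum_filter]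
  refine Finset.sum_congr ?_ fun _ _ => rfl
  ext
  simp

open scoped Classical in
theorem weightSum_inter_diff {R : RCTree G} {A : Set (RCNode G)} {c : RCNode G} {v : Fin n}
    (h : R.CutInside A c) (hc : R.IsChild c v) (hv : Sum.inl v ∈ A) :
    weightSum w (A ∩ ({y | R.Below y (Sum.inl v)} \ {y | R.Below y c})) =
      w (Sum.inl v) + ∑ d : RCNode G, if R.IsChild d v ∧ d ≠ c then
        weightSum w {y | R.Below y d} else 0 := by
  rw [h.inter_diff_eq hc hv, weightSum_union, weightSum_singleton, weightSum_biUnion]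
  · refine congrArg _ (Finset.sum_congr rfl fun d _ => ?_)
    by_cases hd : R.IsChild d v ∧ d ≠ c
    · rw [if_pos hd, if_pos (Set.mem_ofPred_eq ▸ hd)]
    · rw [if_neg hd, if_neg (Set.mem_ofPred_eq ▸ hd)]
  · intro d hd d' hd' hne
    rw [Function.onFun, Set.disjoint_left]
    exact fun y hy hy' => hne (hd.1.eq_of_below hd'.1 hy hy')
  · simp only [Set.disjoint_singleton_left, Set.mem_iUnion, not_exists]
    exact fun d hd => hd.1.not_below_self

end WeightSum

/-! ### Running parallel programs -/

namespace PRAM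

variable {S : Type*}

/-- `1` if `x` and `y` have the same value, else `0`. -/
def WExp.eqTest (x y : WExp) : WExp :=
  .ite (.add (.sub x y) (.sub y x)) (.const 0) (.const 1)

theorem WExp.eval_eqTest (M : Mem S) (p : ℕ) (x y : WExp) :
    (WExp.eqTest x y).eval M p = if x.eval M p = y.eval M p then 1 else 0 := by
  by_cases h : x.eval M p = y.eval M p
  · simp [WExp.eqTest, WExp.eval, h]
  · rw [if_neg h, WExp.eqTest, WExp.eval, if_pos (by simp only [WExp.eval]; omega), WExp.eval]

theorem WExp.eval_eqTest_eq_zero (M : Mem S) (p : ℕ) (x y : WExp) :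
    (WExp.eqTest x y).eval M p = 0 ↔ x.eval M p ≠ y.eval M p := by
  simp [WExp.eval_eqTest]

/-- The memory obtained by storing the word `x` in cell `i` of array `a`. -/
def Mem.setWord (M : Mem S) (a i x : ℕ) : Mem S where
  word a' i' := if a' = a ∧ i' = i then x else M.word a' i'
  elt := M.elt

/-- One processor stores the value of `x` in cell `i` of the word array `a`. -/
def Prog.assign (a i : ℕ) (x : WExp) : Prog :=
  .par (.const 1) [.word (.const 1) a (.const i) x]

variable [AddCommSemigroup S]

theorem exec_assign (M : Mem S) (a i : ℕ) (x : WExp) :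
    Exec (.assign a i x) M (M.setWord a i (x.eval M 0)) 2 1 := by
  refine Exec.par (N := .const 1) ⟨?_, ?_, ?_, ?_⟩
  · rintro p hp a' i' y ⟨g, ad, val, hmem, -, had, hval⟩
    obtain rfl : p = 0 := by simpa [WExp.eval] using hp
    simp only [List.mem_singleton, Write.word.injEq] at hmem
    obtain ⟨rfl, rfl, rfl, rfl⟩ := hmem
    simpa [Mem.setWord, WExp.eval, ← had] using hval
  · intro a' i' h
    refine if_neg ?_
    rintro ⟨rfl, rfl⟩
    exact h 0 (by simp [WExp.eval]) _
      ⟨_, _, _, List.mem_singleton.2 rfl, by simp [WExp.eval], rfl, rfl⟩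
  · rintro p - a' i' y ⟨g, ad, val, hmem, -⟩
    simp at hmem
  · exact fun _ _ _ => rfl

/-- A step is valid if the values written depend only on the cells they are written to. -/
theorem exists_step (M : Mem S) (N : ℕ) (b : List Write) (Fw : ℕ → ℕ → ℕ)
    (Fe : ℕ → ℕ → WithZero S)
    (hw : ∀ p < N, ∀ g a addr val, Write.word g a addr val ∈ b →
      val.eval M p = Fw a (addr.eval M p))
    (he : ∀ p < N, ∀ g a addr val, Write.elt g a addr val ∈ b →
      val.eval M p = Fe a (addr.eval M p)) :
    ∃ M', Step M N b M' := by
  classical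
  refine ⟨⟨fun a i => if ∃ p < N, ∃ x, WritesWord M b p a i x then Fw a i else M.word a i,
    fun a i => if ∃ p < N, ∃ x, WritesElt M b p a i x then Fe a i else M.elt a i⟩, ?_, ?_, ?_, ?_⟩
  · intro p hp a i x h
    have h' : ∃ p < N, ∃ x, WritesWord M b p a i x := ⟨p, hp, x, h⟩
    obtain ⟨g, ad, val, hmem, -, rfl, rfl⟩ := h
    exact (if_pos h').trans (hw p hp _ _ _ _ hmem).symm
  · intro a i h
    exact if_neg fun ⟨p, hp, x, hx⟩ => h p hp x hx
  · intro p hp a i x h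
    have h' : ∃ p < N, ∃ x, WritesElt M b p a i x := ⟨p, hp, x, h⟩
    obtain ⟨g, ad, val, hmem, -, rfl, rfl⟩ := h
    exact (if_pos h').trans (he p hp _ _ _ _ hmem).symm
  · intro a i h
    exact if_neg fun ⟨p, hp, x, hx⟩ => h p hp x hx

theorem Step.word_eq_of_array {M M' : Mem S} {N : ℕ} {b : List Write} (h : Step M N b M') {a : ℕ}
    (ha : ∀ g addr val, Write.word g a addr val ∉ b) (i : ℕ) : M'.word a i = M.word a i :=
  h.word_keep a i fun _ _ _ ⟨g, addr, val, hmem, _⟩ => ha g addr val hmem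

theorem Step.elt_eq_of_array {M M' : Mem S} {N : ℕ} {b : List Write} (h : Step M N b M') {a : ℕ}
    (ha : ∀ g addr val, Write.elt g a addr val ∉ b) (i : ℕ) : M'.elt a i = M.elt a i :=
  h.elt_keep a i fun _ _ _ ⟨g, addr, val, hmem, _⟩ => ha g addr val hmem

/-- A loop that is entered `t` times; `Inv s` holds when `s` iterations remain, and the iteration
that leaves `s` of them has work `W s`. -/
theorem exec_loop {c : WExp} {P : Prog} (Inv : ℕ → Mem S → Prop) (W : ℕ → ℕ) (T : ℕ)
    (hzero : ∀ M, Inv 0 M → c.eval M 0 = 0)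
    (hsucc : ∀ s M, Inv (s + 1) M → c.eval M 0 ≠ 0 ∧ ∃ M', Exec P M M' (W s) T ∧ Inv s M')
    (t : ℕ) (M : Mem S) (hM : Inv t M) :
    ∃ M', Exec (.loop c P) M M' (∑ s ∈ Finset.range t, (W s + 1) + 1) (t * (T + 1) + 1) ∧
      Inv 0 M' := by
  induction t generalizing M with
  | zero => exact ⟨M, by simpa using Exec.loop_stop (hzero M hM), hM⟩
  | succ s ih =>
    obtain ⟨hc, M₁, hexec, hInv⟩ := hsucc s M hM
    obtain ⟨M', hloop, hInv'⟩ := ih M₁ hInv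
    refine ⟨M', ?_, hInv'⟩
    have := Exec.loop_next hc hexec hloop
    convert this using 1
    · rw [Finset.sum_range_succ]
      ring
    · ring

end PRAM

/-! ### The step from a cluster to its parent -/

/-! A set `A` that is cut inside a cluster `c` is described by two bits (words, of which only being
zero or not matters): for each of the two slots for boundary vertices of `c`, whether the vertex
in it belongs to `A`. -/

namespace PRAM

section Values

variable {S : Type*} [AddCommSemigroup S]

/-- The bit of the parent of `c`, which is one of the boundary vertices of `c`. -/
def sideBit (M : Mem S) (c x₀ x₁ : ℕ) : ℕ :=
  if M.word 5 c = M.word 4 c then x₀ else x₁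

/-- The bit of the vertex in slot `t` of the parent of `c`: its bit at `c` if it is a boundary
vertex of `c`, else the bit of the parent. The bit of an empty slot is arbitrary. -/
def parentBit (M : Mem S) (t c x₀ x₁ : ℕ) : ℕ :=
  if M.word (5 + t) (M.word 4 c - 1) = M.word 5 c then x₀
  else if M.word (5 + t) (M.word 4 c - 1) = M.word 6 c then x₁ else sideBit M c x₀ x₁

/-- The total weight of the siblings of `c` among the first `j` children of its parent. -/
def siblingSum (M : Mem S) (c j : ℕ) : WithZero S :=
  ∑ i ∈ Finset.range j, if M.word (10 + i) (M.word 4 c - 1) = 0 then 0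
    else if M.word (10 + i) (M.word 4 c - 1) = c + 1 then 0
    else M.elt 0 (M.word (10 + i) (M.word 4 c - 1) - 1)

/-- The weight in the parent of `c`, but outside `c`, that belongs to the set described by the
bits. -/
def gain (D : ℕ) (M : Mem S) (c x₀ x₁ : ℕ) : WithZero S :=
  if sideBit M c x₀ x₁ ≠ 0 then M.elt 1 (M.word 4 c - 1) + siblingSum M c D else 0

/-- The entry of the table of outside weights for the vertex `v` and two bits. -/
def outsideEntry (M : Mem S) (v x₀ x₁ : ℕ) : WithZero S :=
  if x₁ ≠ 0 then (if x₀ ≠ 0 then M.elt 6 v else M.elt 5 v)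
  else if x₀ ≠ 0 then M.elt 4 v else M.elt 3 v

/-- The weight outside `c` that belongs to the set described by the bits, computed from the table
entry of the parent of `c`. -/
def outsideValue (D : ℕ) (M : Mem S) (c x₀ x₁ : ℕ) : WithZero S :=
  if M.word 4 c ≠ 0 then gain D M c x₀ x₁ + outsideEntry M (M.word 4 c - 1)
    (parentBit M 0 c x₀ x₁) (parentBit M 1 c x₀ x₁)
  else 0

end Values

section Expressions

/-- The expression for `sideBit`. -/
def sideBitE (c x₀ x₁ : WExp) : WExp :=
  .ite (.eqTest (.get 5 c) (.get 4 c)) x₀ x₁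

/-- The expression for the representative of the parent of `c`. -/
def parentE (c : WExp) : WExp :=
  .sub (.get 4 c) (.const 1)

/-- The expression for `parentBit`. -/
def parentBitE (t : ℕ) (c x₀ x₁ : WExp) : WExp :=
  .ite (.eqTest (.get (5 + t) (parentE c)) (.get 5 c)) x₀
    (.ite (.eqTest (.get (5 + t) (parentE c)) (.get 6 c)) x₁ (sideBitE c x₀ x₁))

/-- The expression for `siblingSum`. -/
def siblingSumE (c : WExp) : ℕ → EExp
  | 0 => .empty
  | j + 1 => .add (siblingSumE c j)
      (.ite (.get (10 + j) (parentE c))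
        (.ite (.eqTest (.get (10 + j) (parentE c)) (.add c (.const 1))) .empty
          (.get 0 (.sub (.get (10 + j) (parentE c)) (.const 1))))
        .empty)

/-- The expression for `gain`. -/
def gainE (D : ℕ) (c x₀ x₁ : WExp) : EExp :=
  .ite (sideBitE c x₀ x₁) (.add (.get 1 (parentE c)) (siblingSumE c D)) .empty

/-- The expression for `outsideEntry`. -/
def outsideEntryE (v x₀ x₁ : WExp) : EExp :=
  .ite x₁ (.ite x₀ (.get 6 v) (.get 5 v)) (.ite x₀ (.get 4 v) (.get 3 v))

/-- The expression for `outsideValue`. -/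
def outsideValueE (D : ℕ) (c x₀ x₁ : WExp) : EExp :=
  .ite (.get 4 c) (.add (gainE D c x₀ x₁)
    (outsideEntryE (parentE c) (parentBitE 0 c x₀ x₁) (parentBitE 1 c x₀ x₁))) .empty

/-- Whether the node with number `x - 1` is the base cluster of the edge `{u, p}`; `0` if `x` is
`0`. -/
def isEdgeE (x u p : WExp) : WExp :=
  .ite (.sub x (.get 0 (.const 0)))
    (.ite (.eqTest (.get 5 (.sub x (.const 1))) (.add u (.const 1)))
      (.eqTest (.get 6 (.sub x (.const 1))) (.add p (.const 1)))
      (.ite (.eqTest (.get 5 (.sub x (.const 1))) (.add p (.const 1)))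
        (.eqTest (.get 6 (.sub x (.const 1))) (.add u (.const 1))) (.const 0)))
    (.const 0)

/-- The number of the base cluster of the edge `{u, p}`, if it is one of the first `j` children of
`u` or of `p`. -/
def findEdgeE (u p : WExp) : ℕ → WExp
  | 0 => .const 0
  | j + 1 => .ite (isEdgeE (.get (10 + j) u) u p) (.sub (.get (10 + j) u) (.const 1))
      (.ite (isEdgeE (.get (10 + j) p) u p) (.sub (.get (10 + j) p) (.const 1)) (findEdgeE u p j))

variable {S : Type*} (M : Mem S) (r : ℕ) (c x₀ x₁ : WExp)

theorem eval_parentE : (parentE c).eval M r = M.word 4 (c.eval M r) - 1 := rfl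

theorem eval_sideBitE :
    (sideBitE c x₀ x₁).eval M r = sideBit M (c.eval M r) (x₀.eval M r) (x₁.eval M r) := by
  simp [sideBitE, sideBit, WExp.eval, WExp.eval_eqTest_eq_zero]

theorem eval_parentBitE (t : ℕ) : (parentBitE t c x₀ x₁).eval M r =
    parentBit M t (c.eval M r) (x₀.eval M r) (x₁.eval M r) := by
  simp [parentBitE, parentBit, WExp.eval, WExp.eval_eqTest_eq_zero, eval_sideBitE, eval_parentE]

variable [AddCommSemigroup S]

theorem eval_siblingSumE (j : ℕ) :
    (siblingSumE c j).eval M r = siblingSum M (c.eval M r) j := by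
  induction j with
  | zero => rfl
  | succ j ih =>
    rw [siblingSum, Finset.sum_range_succ, ← siblingSum, ← ih]
    simp [siblingSumE, EExp.eval, WExp.eval, WExp.eval_eqTest_eq_zero, eval_parentE]

theorem eval_gainE (D : ℕ) : (gainE D c x₀ x₁).eval M r =
    gain D M (c.eval M r) (x₀.eval M r) (x₁.eval M r) := by
  simp only [gainE, gain, EExp.eval, eval_sideBitE, eval_siblingSumE, eval_parentE]

theorem eval_outsideEntryE : (outsideEntryE c x₀ x₁).eval M r =
    outsideEntry M (c.eval M r) (x₀.eval M r) (x₁.eval M r) := rfl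

theorem eval_outsideValueE (D : ℕ) : (outsideValueE D c x₀ x₁).eval M r =
    outsideValue D M (c.eval M r) (x₀.eval M r) (x₁.eval M r) := by
  simp only [outsideValueE, outsideValue, EExp.eval, WExp.eval, eval_gainE, eval_outsideEntryE,
    eval_parentE, eval_parentBitE]

end Expressions

end PRAM

/-! ### Reading the stored RC-tree -/

theorem RCNode.code_injective {n m : ℕ} {G : SimpleGraph (Fin n)} (E : G.edgeSet ≃ Fin m) :
    Function.Injective (RCNode.code E) := by
  rintro (v | e) (v' | e') h <;> simp only [RCNode.code] at h
  · rw [Fin.ext h]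
  · omega
  · omega
  · rw [E.injective (Fin.ext (by omega : (E e : ℕ) = E e'))]

/-- The bits `x₀`, `x₁` describe the set `A` on the boundary of the cluster `c`. -/
def BitsMatch {n m : ℕ} {G : SimpleGraph (Fin n)} {S : Type*} (E : G.edgeSet ≃ Fin m)
    (M : PRAM.Mem S) (A : Set (RCNode G)) (c : RCNode G) (x₀ x₁ : ℕ) : Prop :=
  ∀ b : Fin n, (M.word 5 (c.code E) = b + 1 → (x₀ ≠ 0 ↔ Sum.inl b ∈ A)) ∧
    (M.word 6 (c.code E) = b + 1 → (x₁ ≠ 0 ↔ Sum.inl b ∈ A))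

namespace Holds

open PRAM

variable {D n m k : ℕ} {G : SimpleGraph (Fin n)} {S : Type*} [AddCommSemigroup S]
  {E : G.edgeSet ≃ Fin m} {R : RCTree G} {w : RCNode G → S} {q : Fin k → Fin n × Fin n}
  {M : Mem S}

theorem of_agree (h : Holds D E R w q M) {M' : Mem S}
    (hw : ∀ a < 10 + D, ∀ i, M'.word a i = M.word a i)
    (he : ∀ a < 2, ∀ i, M'.elt a i = M.elt a i) : Holds D E R w q M' := by
  have hb : ∀ (b : ℕ) (N : ℕ), b + N ≤ 10 + D → ∀ (i : ℕ) (A : Set ℕ),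
      Slots (fun j => M.word (b + j) i) N A → Slots (fun j => M'.word (b + j) i) N A := by
    intro b N hbN i A hs
    refine ⟨fun j hj => ?_, fun a ha => ?_⟩
    · simp only [hw (b + j) (by omega)]
      exact hs.1 j hj
    · obtain ⟨j, ⟨hj, hja⟩, huniq⟩ := hs.2 a ha
      refine ⟨j, ⟨hj, ?_⟩, fun j' ⟨hj', hja'⟩ => huniq j' ⟨hj', ?_⟩⟩
      · simp only [hw (b + j) (by omega)]
        exact hja
      · simpa only [hw (b + j') (by omega)] using hja'
  refine ⟨?_, ?_, fun j => ?_, fun j => ?_, fun v => ?_, fun c => ?_, fun c => ?_, fun i hi => ?_,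
    fun i hi => ?_, fun v => ?_, fun c => ?_, fun v => ?_⟩
  · rw [hw 0 (by omega), h.card_vertices]
  · rw [hw 0 (by omega), h.card_queries]
  · rw [hw 1 (by omega), h.query_root]
  · rw [hw 2 (by omega), h.query_parent]
  · rw [hw 3 (by omega), h.round]
  · simp only [hw 4 (by omega)]
    exact h.parent c
  · exact hb 5 2 (by omega) _ _ (h.boundary c)
  · rw [hw 7 (by omega), h.live_card i hi]
  · simp only [hw 8 (by omega), hw 9 (by omega)]
    exact h.live_list i hi
  · exact hb 10 D (by omega) _ _ (h.children v)
  · rw [he 0 (by omega), h.total]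
  · rw [he 1 (by omega), h.weight]

theorem parent_eq (h : Holds D E R w q M) {c : RCNode G} {v : Fin n} (hc : R.IsChild c v) :
    M.word 4 (c.code E) = v + 1 := by
  obtain ⟨j, ⟨-, hj⟩, -⟩ := (h.parent c).2 v ⟨v, hc, rfl⟩
  exact hj

theorem parent_cases (h : Holds D E R w q M) (c : RCNode G) :
    (M.word 4 (c.code E) = 0 ∧ R.boundary c = ∅) ∨
      ∃ v : Fin n, R.IsChild c v ∧ M.word 4 (c.code E) = v + 1 := by
  rcases (R.boundary c).eq_empty_or_nonempty with hb | hb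
  · refine Or.inl ⟨((h.parent c).1 0 one_pos).resolve_right ?_, hb⟩
    rintro ⟨_, ⟨v, hv, -⟩, -⟩
    have := hv.1
    simp [hb] at this
  · obtain ⟨v, hv⟩ := RCTree.exists_isChild_of_boundary_nonempty hb
    exact Or.inr ⟨v, hv, h.parent_eq hv⟩

theorem slot_of_mem_boundary (h : Holds D E R w q M) {c : RCNode G} {b : Fin n}
    (hb : b ∈ R.boundary c) : M.word 5 (c.code E) = b + 1 ∨ M.word 6 (c.code E) = b + 1 := by
  obtain ⟨j, ⟨hj, hjb⟩, -⟩ := (h.boundary c).2 b ⟨b, hb, rfl⟩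
  interval_cases j
  · exact Or.inl hjb
  · exact Or.inr hjb

theorem mem_boundary_of_slot (h : Holds D E R w q M) {c : RCNode G} {b : Fin n} {t : ℕ}
    (ht : t < 2) (hb : M.word (5 + t) (c.code E) = b + 1) : b ∈ R.boundary c := by
  rcases (h.boundary c).1 t ht with h0 | ⟨_, ⟨v, hv, rfl⟩, hv'⟩
  · simp only [hb] at h0
    omega
  · simp only [hb] at hv'
    rwa [Fin.ext (by omega : (b : ℕ) = v)]

theorem sideBit_iff (h : Holds D E R w q M) {A : Set (RCNode G)} {c : RCNode G} {v : Fin n}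
    (hc : R.IsChild c v) {x₀ x₁ : ℕ} (hx : BitsMatch E M A c x₀ x₁) :
    sideBit M (c.code E) x₀ x₁ ≠ 0 ↔ Sum.inl v ∈ A := by
  rw [sideBit, h.parent_eq hc]
  split_ifs with h5
  · exact (hx v).1 h5
  · exact (hx v).2 ((h.slot_of_mem_boundary hc.1).resolve_left h5)

theorem parentBit_iff (h : Holds D E R w q M) {A : Set (RCNode G)} {c : RCNode G} {v : Fin n}
    (hA : R.CutInside A c) (hc : R.IsChild c v) {x₀ x₁ : ℕ} (hx : BitsMatch E M A c x₀ x₁)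
    {t : ℕ} (ht : t < 2) {b : Fin n}
    (hb : M.word (5 + t) (RCNode.code E (Sum.inl v : RCNode G)) = b + 1) :
    parentBit M t (c.code E) x₀ x₁ ≠ 0 ↔ Sum.inl b ∈ A := by
  have hv : M.word 4 (c.code E) - 1 = RCNode.code E (Sum.inl v : RCNode G) := by
    rw [h.parent_eq hc]
    rfl
  rw [parentBit, hv, hb]
  split_ifs with h5 h6
  · exact (hx b).1 h5.symm
  · exact (hx b).2 h6.symm
  · rw [h.sideBit_iff hc hx, hA.mem_boundary_parent hc (h.mem_boundary_of_slot ht hb)]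
    intro hbc
    rcases h.slot_of_mem_boundary hbc with h' | h'
    · exact h5 h'.symm
    · exact h6 h'.symm

theorem bitsMatch_parent (h : Holds D E R w q M) {A : Set (RCNode G)} {c : RCNode G} {v : Fin n}
    (hA : R.CutInside A c) (hc : R.IsChild c v) {x₀ x₁ : ℕ} (hx : BitsMatch E M A c x₀ x₁) :
    BitsMatch E M A (Sum.inl v) (parentBit M 0 (c.code E) x₀ x₁)
      (parentBit M 1 (c.code E) x₀ x₁) :=
  fun _ => ⟨h.parentBit_iff hA hc hx two_pos, h.parentBit_iff hA hc hx one_lt_two⟩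

open scoped Classical in
theorem siblingSum_eq (h : Holds D E R w q M) {c : RCNode G} {v : Fin n} (hc : R.IsChild c v) :
    siblingSum M (c.code E) D =
      ∑ d : RCNode G, if R.IsChild d v ∧ d ≠ c then weightSum w {y | R.Below y d} else 0 := by
  have hv : M.word 4 (c.code E) - 1 = v := by rw [h.parent_eq hc]; rfl
  have hs := h.children v
  -- Each slot contributes the terms of the children stored in it, of which there is at most one.
  have hterm : ∀ i ∈ Finset.range D, (if M.word (10 + i) v = 0 then 0
      else if M.word (10 + i) v = c.code E + 1 then 0 else M.elt 0 (M.word (10 + i) v - 1)) =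
      ∑ d : RCNode G, if M.word (10 + i) v = d.code E + 1 then
        (if R.IsChild d v ∧ d ≠ c then weightSum w {y | R.Below y d} else 0) else 0 := by
    intro i hi
    rcases hs.1 i (Finset.mem_range.1 hi) with h0 | ⟨_, ⟨d, hd, rfl⟩, hid⟩
    · dsimp only at h0
      simp [h0]
    · dsimp only at hid
      rw [Finset.sum_eq_single d]
      · by_cases hdc : d = c
        · simp [hid, hdc]
        · have : d.code E ≠ c.code E := fun h' => hdc (RCNode.code_injective E h')
          simp [hid, hdc, hd, this, h.total]
      · intro d' _ hd'
        refine if_neg fun h' => hd' (RCNode.code_injective E ?_)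
        omega
      · simp
  rw [siblingSum, hv, Finset.sum_congr rfl hterm, Finset.sum_comm]
  refine Finset.sum_congr rfl fun d _ => ?_
  by_cases hd : R.IsChild d v ∧ d ≠ c
  · obtain ⟨j, ⟨hj, hjd⟩, huniq⟩ := hs.2 (d.code E) ⟨d, hd.1, rfl⟩
    rw [Finset.sum_eq_single j]
    · dsimp only at hjd
      rw [if_pos hjd]
    · intro j' hj' hne
      exact if_neg fun h' => hne (huniq j' ⟨Finset.mem_range.1 hj', h'⟩)
    · intro h'
      exact absurd (Finset.mem_range.2 hj) h'
  · simp [hd]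

theorem gain_eq (h : Holds D E R w q M) {A : Set (RCNode G)} {c : RCNode G} {v : Fin n}
    (hA : R.CutInside A c) (hc : R.IsChild c v) {x₀ x₁ : ℕ} (hx : BitsMatch E M A c x₀ x₁) :
    gain D M (c.code E) x₀ x₁ =
      weightSum w (A ∩ ({y | R.Below y (Sum.inl v)} \ {y | R.Below y c})) := by
  classical
  have hv : M.word 4 (c.code E) - 1 = v := by rw [h.parent_eq hc]; rfl
  rw [gain, h.siblingSum_eq hc, hv, h.weight]
  by_cases hmem : Sum.inl v ∈ A
  · rw [if_pos ((h.sideBit_iff hc hx).2 hmem), weightSum_inter_diff w hA hc hmem]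
  · rw [if_neg (mt (h.sideBit_iff hc hx).1 hmem), hA.inter_diff_eq_empty hc hmem, weightSum_empty]

/-- The total weight inside the cluster grows by the gain in a step to the parent. -/
theorem inside_add_gain (h : Holds D E R w q M) {A : Set (RCNode G)} {c : RCNode G} {v : Fin n}
    (hA : R.CutInside A c) (hc : R.IsChild c v) {x₀ x₁ : ℕ} (hx : BitsMatch E M A c x₀ x₁) :
    weightSum w (A ∩ {y | R.Below y c}) + gain D M (c.code E) x₀ x₁ =
      weightSum w (A ∩ {y | R.Below y (Sum.inl v)}) := by
  have hsub : {y | R.Below y c} ⊆ {y | R.Below y (Sum.inl v)} := fun y hy => hy.trans hc.below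
  rw [h.gain_eq hA hc hx, ← weightSum_union, ← Set.inter_union_distrib_left,
    Set.union_sdiff_cancel hsub]
  exact Set.disjoint_sdiff_right.mono Set.inter_subset_right Set.inter_subset_right

/-- The table of outside weights is correct at `v`. -/
def TableCorrect (_ : Holds D E R w q M) (v : Fin n) : Prop :=
  ∀ A : Set (RCNode G), R.CutInside A (Sum.inl v) → ∀ x₀ x₁ : ℕ,
    BitsMatch E M A (Sum.inl v) x₀ x₁ →
      outsideEntry M v x₀ x₁ = weightSum w (A \ {y | R.Below y (Sum.inl v)})

theorem outsideValue_eq (h : Holds D E R w q M) {A : Set (RCNode G)} {c : RCNode G}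
    (hA : R.CutInside A c) {x₀ x₁ : ℕ} (hx : BitsMatch E M A c x₀ x₁)
    (htab : ∀ v, R.IsChild c v → h.TableCorrect v) :
    outsideValue D M (c.code E) x₀ x₁ = weightSum w (A \ {y | R.Below y c}) := by
  rcases h.parent_cases c with ⟨h0, hb⟩ | ⟨v, hc, hv⟩
  · rw [outsideValue, h0, if_neg (by simp),
      Set.sdiff_eq_empty.2 (hA.subset_of_root hb), weightSum_empty]
  · have hsub : {y | R.Below y c} ⊆ {y | R.Below y (Sum.inl v)} := fun y hy => hy.trans hc.below
    rw [outsideValue, if_pos (by omega), h.gain_eq hA hc hx, hv, Nat.add_sub_cancel,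
      htab v hc A (hA.parent hc) _ _ (h.bitsMatch_parent hA hc hx), ← weightSum_union]
    · congr 1
      ext y
      have := @hsub y
      simp only [Set.mem_union, Set.mem_inter_iff, Set.mem_sdiff]
      tauto
    · rw [Set.disjoint_left]
      exact fun y hy hy' => hy'.2 hy.2.1

theorem isEdgeE_iff (h : Holds D E R w q M) {e : G.edgeSet} {u p : Fin n}
    (he : (e : Sym2 (Fin n)) = s(u, p)) (d : RCNode G) (r : ℕ) (x U P : WExp)
    (hx : x.eval M r = d.code E + 1) (hU : U.eval M r = u) (hP : P.eval M r = p) :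
    (isEdgeE x U P).eval M r ≠ 0 ↔ d = Sum.inr e := by
  have hcode : d.code E + 1 - n ≠ 0 ↔ ∃ e', d = Sum.inr e' := by
    cases d with
    | inl v => simp only [RCNode.code, reduceCtorEq, exists_false, iff_false]; omega
    | inr e' => simp only [RCNode.code, Sum.inr.injEq, exists_eq', iff_true]; omega
  have hmem : ∀ y, y ∈ R.boundary (Sum.inr e) ↔ y = u ∨ y = p := fun y => by
    rw [R.mem_boundary_edge, he, Sym2.mem_iff]
  have hup : u ≠ p := G.ne_of_adj (by rw [← SimpleGraph.mem_edgeSet, ← he]; exact e.2)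
  have hup' : (u : ℕ) ≠ p := fun h' => hup (Fin.ext h')
  simp only [isEdgeE, WExp.eval, WExp.eval_eqTest, hx, hU, hP, h.card_vertices,
    Nat.add_sub_cancel]
  constructor
  · intro hne
    have hn : d.code E + 1 - n ≠ 0 := fun h0 => by simp [h0] at hne
    obtain ⟨e', rfl⟩ := hcode.1 hn
    rw [if_pos hn] at hne
    have hu' : u ∈ R.boundary (Sum.inr e') ∧ p ∈ R.boundary (Sum.inr e') := by
      by_cases h5 : M.word 5 (RCNode.code E (Sum.inr e' : RCNode G)) = u + 1
      · by_cases h6 : M.word 6 (RCNode.code E (Sum.inr e' : RCNode G)) = p + 1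
        · exact ⟨h.mem_boundary_of_slot two_pos h5, h.mem_boundary_of_slot one_lt_two h6⟩
        · simp [h5, h6] at hne
      · by_cases h5' : M.word 5 (RCNode.code E (Sum.inr e' : RCNode G)) = p + 1
        · by_cases h6 : M.word 6 (RCNode.code E (Sum.inr e' : RCNode G)) = u + 1
          · exact ⟨h.mem_boundary_of_slot one_lt_two h6, h.mem_boundary_of_slot two_pos h5'⟩
          · simp [h5', h6, hup'.symm] at hne
        · simp [h5, h5'] at hne
    rw [R.mem_boundary_edge, R.mem_boundary_edge] at hu'
    rw [Subtype.ext (((Sym2.mem_and_mem_iff hup).1 hu').trans he.symm)]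
  · rintro rfl
    rw [if_pos (hcode.2 ⟨e, rfl⟩)]
    have h1 := h.slot_of_mem_boundary ((hmem u).2 (Or.inl rfl))
    have h2 := h.slot_of_mem_boundary ((hmem p).2 (Or.inr rfl))
    split_ifs <;> simp_all

theorem findEdgeE_eq (h : Holds D E R w q M) {e : G.edgeSet} {u p : Fin n}
    (he : (e : Sym2 (Fin n)) = s(u, p)) (r : ℕ) (U P : WExp) (hU : U.eval M r = u)
    (hP : P.eval M r = p) :
    (findEdgeE U P D).eval M r = RCNode.code E (Sum.inr e : RCNode G) := by
  -- A child that passes the test is the base cluster of `e`; for an empty slot the test fails.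
  have hchild : ∀ (v : Fin n) (V : WExp), V.eval M r = v → ∀ i < D,
      (isEdgeE (.get (10 + i) V) U P).eval M r ≠ 0 →
        (WExp.get (10 + i) V).eval M r = RCNode.code E (Sum.inr e : RCNode G) + 1 := by
    intro v V hV i hi hne
    rcases (h.children v).1 i hi with h0 | ⟨_, ⟨d, -, rfl⟩, hd⟩
    · simp [isEdgeE, WExp.eval, hV, h0] at hne
    · have hd' : (WExp.get (10 + i) V).eval M r = d.code E + 1 := by rw [WExp.eval, hV]; exact hd
      rw [hd', (h.isEdgeE_iff he d r _ U P hd' hU hP).1 hne]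
  have hfind : ∀ j ≤ D, (∃ i < j, (isEdgeE (.get (10 + i) U) U P).eval M r ≠ 0 ∨
      (isEdgeE (.get (10 + i) P) U P).eval M r ≠ 0) →
      (findEdgeE U P j).eval M r = RCNode.code E (Sum.inr e : RCNode G) := by
    intro j
    induction j with
    | zero => rintro - ⟨i, hi, -⟩; omega
    | succ j ih =>
      rintro hj ⟨i, hi, hi'⟩
      rw [findEdgeE, WExp.eval]
      split_ifs with h1
      · rw [WExp.eval, hchild u U hU j hj h1]; rfl
      rw [WExp.eval]
      split_ifs with h2
      · rw [WExp.eval, hchild p P hP j hj h2]; rfl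
      · refine ih (by omega) ⟨i, lt_of_le_of_ne (by omega) ?_, hi'⟩
        rintro rfl
        exact hi'.elim h1 h2
  obtain ⟨v, hv⟩ : ∃ v, R.IsChild (Sum.inr e) v :=
    RCTree.exists_isChild_of_boundary_nonempty ⟨u, by
      rw [R.mem_boundary_edge, he]; exact Sym2.mem_mk_left u p⟩
  obtain ⟨i, ⟨hi, hie⟩, -⟩ := (h.children v).2 _ ⟨_, hv, rfl⟩
  have hvup : v = u ∨ v = p := by
    rw [← Sym2.mem_iff, ← he, ← R.mem_boundary_edge]
    exact hv.1
  refine hfind D le_rfl ⟨i, hi, ?_⟩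
  rcases hvup with rfl | rfl
  · exact Or.inl ((h.isEdgeE_iff he _ r _ U P (by rw [WExp.eval, hU]; exact hie) hU hP).2 rfl)
  · exact Or.inr ((h.isEdgeE_iff he _ r _ U P (by rw [WExp.eval, hP]; exact hie) hU hP).2 rfl)

end Holds

/-! ### The program -/

/-! The word array `10 + D` holds two registers, and the arrays `11 + D`, `12 + D` and `13 + D` hold for
each query the number of its current cluster and the two bits for the boundary vertices of this
cluster. The semigroup array `2` holds the partial sums of the queries, and the arrays `3` to `6`
hold the table of outside weights, one array for each pair of bits. -/

namespace PRAM

/-- The current cluster of the query of a processor. -/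
def curE (D : ℕ) : WExp := .get (11 + D) .pid

/-- The bits of the current cluster of the query of a processor: in slot `0` for `t = 0`, in
slot `1` for `t = 1`. -/
def bitE (D t : ℕ) : WExp := .get (12 + D + t) .pid

/-- Set register `i` to the least number for which `c` has the value `0`. -/
def searchProg (D i : ℕ) (c : WExp) : Prog :=
  .seq (.assign (10 + D) i (.const 0))
    (.loop c (.assign (10 + D) i (.add (.get (10 + D) (.const i)) (.const 1))))

/-- Compute the table of outside weights for the vertices that are live in the round in
register `0`. -/
def tableStep (D : ℕ) : Prog :=
  let v : WExp := .get 9 (.add (.get 8 (.get (10 + D) (.const 0))) .pid)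
  .par (.get 7 (.get (10 + D) (.const 0)))
    [.elt (.const 1) 3 v (outsideValueE D v (.const 0) (.const 0)),
     .elt (.const 1) 4 v (outsideValueE D v (.const 1) (.const 0)),
     .elt (.const 1) 5 v (outsideValueE D v (.const 0) (.const 1)),
     .elt (.const 1) 6 v (outsideValueE D v (.const 1) (.const 1))]

/-- For each query, replace the current cluster, its bits and the partial sum. -/
def updateQueries (D : ℕ) (c x₀ x₁ : WExp) (s : EExp) : Prog :=
  .par (.get 0 (.const 1))
    [.word (.const 1) (11 + D) .pid c, .word (.const 1) (12 + D) .pid x₀,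
     .word (.const 1) (13 + D) .pid x₁, .elt (.const 1) 2 .pid s]

/-- Each query `(u, p)` starts at the base cluster of the edge `{u, p}`. -/
def queryInit (D : ℕ) : Prog :=
  let c : WExp := findEdgeE (.get 1 .pid) (.get 2 .pid) D
  updateQueries D c (.eqTest (.get 5 c) (.add (.get 1 .pid) (.const 1)))
    (.eqTest (.get 6 c) (.add (.get 1 .pid) (.const 1))) .empty

/-- Each query moves to the parent of its current cluster, unless this is a root. -/
def queryStep (D : ℕ) : Prog :=
  updateQueries D (.ite (.get 4 (curE D)) (parentE (curE D)) (curE D))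
    (.ite (.get 4 (curE D)) (parentBitE 0 (curE D) (bitE D 0) (bitE D 1)) (bitE D 0))
    (.ite (.get 4 (curE D)) (parentBitE 1 (curE D) (bitE D 0) (bitE D 1)) (bitE D 1))
    (.add (.get 2 .pid) (.ite (.get 4 (curE D)) (gainE D (curE D) (bitE D 0) (bitE D 1)) .empty))

/-- Each query adds the weight outside its current cluster. -/
def queryFinish (D : ℕ) : Prog :=
  updateQueries D (curE D) (bitE D 0) (bitE D 1)
    (.add (.get 2 .pid) (outsideValueE D (curE D) (bitE D 0) (bitE D 1)))

/-- Decrease register `i` by one. -/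
def decrease (D i : ℕ) : Prog :=
  .assign (10 + D) i (.sub (.get (10 + D) (.const i)) (.const 1))

/-- The program that answers batches of subtree queries. Register `0` first holds the number of
rounds, register `1` the first round `i₀` with at most as many live vertices as there are queries.
The table of outside weights is computed for the rounds from `i₀` on, from the last to the first.
Then every query climbs the tree for `i₀` rounds, and looks up the rest in the table. -/
def queryProg (D : ℕ) : Prog :=
  .seq (searchProg D 0 (.get 7 (.get (10 + D) (.const 0)))) <|
  .seq (searchProg D 1 (.sub (.get 7 (.get (10 + D) (.const 1))) (.get 0 (.const 1)))) <|
  .seq (.loop (.sub (.get (10 + D) (.const 0)) (.get (10 + D) (.const 1)))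
    (.seq (decrease D 0) (tableStep D))) <|
  .seq (queryInit D) <|
  .seq (.loop (.get (10 + D) (.const 1)) (.seq (decrease D 1) (queryStep D))) <|
  queryFinish D

/-! ### Correctness and cost of the program -/

variable {S : Type*} [AddCommSemigroup S]

theorem exec_searchProg (D i t : ℕ) (c : WExp) (M : Mem S)
    (hc : ∀ s ≤ t, c.eval (M.setWord (10 + D) i s) 0 ≠ 0 ↔ s < t) :
    Exec (searchProg D i c) M (M.setWord (10 + D) i t) (3 * t + 3) (2 * t + 2) := by
  have hset : ∀ x y, (M.setWord (10 + D) i x).setWord (10 + D) i y = M.setWord (10 + D) i y := by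
    intro x y
    simp only [Mem.setWord, Mem.mk.injEq, and_true]
    funext a i'
    split_ifs <;> rfl
  have h := exec_assign M (10 + D) i (.const 0)
  obtain ⟨M', hexec, hM', -⟩ := exec_loop (c := c)
    (P := .assign (10 + D) i (.add (.get (10 + D) (.const i)) (.const 1)))
    (fun s M' => M' = M.setWord (10 + D) i (t - s) ∧ s ≤ t) (fun _ => 2) 1
    (by
      rintro _ ⟨rfl, -⟩
      by_contra h
      exact lt_irrefl t ((hc t le_rfl).1 h))
    (by
      rintro s _ ⟨rfl, hs⟩
      refine ⟨(hc _ (by omega)).2 (by omega), _, exec_assign _ _ _ _, ?_, by omega⟩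
      rw [hset]
      congr 1
      simp [WExp.eval, Mem.setWord]
      omega)
    t (M.setWord (10 + D) i 0) ⟨by simp, le_rfl⟩
  rw [hM', Nat.sub_zero] at hexec
  have hW : 2 + (∑ _s ∈ Finset.range t, (2 + 1) + 1) = 3 * t + 3 := by
    rw [Finset.sum_const, Finset.card_range, smul_eq_mul]
    ring
  have hT : 1 + (t * (1 + 1) + 1) = 2 * t + 2 := by ring
  exact hT ▸ hW ▸ Exec.seq h hexec

theorem exec_updateQueries (D k : ℕ) (M : Mem S) (hk : M.word 0 1 = k) (c x₀ x₁ : WExp)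
    (s : EExp) : ∃ M', Exec (updateQueries D c x₀ x₁ s) M M' (k + 1) 1 ∧
      (∀ j < k, M'.word (11 + D) j = c.eval M j ∧ M'.word (12 + D) j = x₀.eval M j ∧
        M'.word (13 + D) j = x₁.eval M j ∧ M'.elt 2 j = s.eval M j) ∧
      (∀ a < 11 + D, ∀ i, M'.word a i = M.word a i) ∧ ∀ a ≠ 2, ∀ i, M'.elt a i = M.elt a i := by
  subst hk
  obtain ⟨M', hstep⟩ := exists_step M (M.word 0 1)
    [.word (.const 1) (11 + D) .pid c, .word (.const 1) (12 + D) .pid x₀,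
      .word (.const 1) (13 + D) .pid x₁, .elt (.const 1) 2 .pid s]
    (fun a i => if a = 11 + D then c.eval M i else if a = 12 + D then x₀.eval M i
      else x₁.eval M i) (fun _ i => s.eval M i)
    (by
      intro p _ g a addr val hmem
      simp only [List.mem_cons, Write.word.injEq, List.not_mem_nil, reduceCtorEq, or_false] at hmem
      rcases hmem with ⟨-, rfl, rfl, rfl⟩ | ⟨-, rfl, rfl, rfl⟩ | ⟨-, rfl, rfl, rfl⟩ <;>
        simp [WExp.eval])
    (by
      intro p _ g a addr val hmem
      simp only [List.mem_cons, Write.elt.injEq, List.not_mem_nil, reduceCtorEq, or_false,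
        false_or] at hmem
      obtain ⟨-, rfl, rfl, rfl⟩ := hmem
      rfl)
  refine ⟨M', Exec.par hstep, fun j hj => ⟨?_, ?_, ?_, ?_⟩, fun a ha => ?_, fun a ha => ?_⟩
  · exact hstep.word_write j hj _ _ _ ⟨.const 1, .pid, c, by simp, by simp [WExp.eval], rfl, rfl⟩
  · exact hstep.word_write j hj _ _ _ ⟨.const 1, .pid, x₀, by simp, by simp [WExp.eval], rfl, rfl⟩
  · exact hstep.word_write j hj _ _ _ ⟨.const 1, .pid, x₁, by simp, by simp [WExp.eval], rfl, rfl⟩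
  · exact hstep.elt_write j hj _ _ _ ⟨.const 1, .pid, s, by simp, by simp [WExp.eval], rfl, rfl⟩
  · refine hstep.word_eq_of_array fun g addr val hmem => ?_
    simp only [List.mem_cons, Write.word.injEq, List.not_mem_nil, reduceCtorEq, or_false] at hmem
    omega
  · refine hstep.elt_eq_of_array fun g addr val hmem => ?_
    simp [ha] at hmem

end PRAM

namespace RCTree

variable {n : ℕ} {G : SimpleGraph (Fin n)} (R : RCTree G)

theorem live_card_pos_iff {i : ℕ} : 0 < (R.live i).card ↔ i < R.rounds := by
  rw [Finset.card_pos, rounds, Finset.lt_sup_iff]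
  simp only [Finset.Nonempty, live, Finset.mem_filter, Finset.mem_univ, true_and]
  exact exists_congr fun v => Nat.lt_succ_iff.symm

end RCTree

namespace Holds

open PRAM

variable {D n m k : ℕ} {G : SimpleGraph (Fin n)} {S : Type*} [AddCommSemigroup S]
  {E : G.edgeSet ≃ Fin m} {R : RCTree G} {w : RCNode G → S} {q : Fin k → Fin n × Fin n}
  {M : Mem S}

theorem setRegister (h : Holds D E R w q M) (i x : ℕ) :
    Holds D E R w q (M.setWord (10 + D) i x) := by
  refine h.of_agree (fun a ha _ => if_neg ?_) fun _ _ _ => rfl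
  omega

theorem TableCorrect.of_agree {h : Holds D E R w q M} {v : Fin n} (htab : h.TableCorrect v)
    {M' : Mem S} (h' : Holds D E R w q M') (hw : ∀ a < 10 + D, ∀ i, M'.word a i = M.word a i)
    (he : ∀ a ≠ 2, ∀ i, M'.elt a i = M.elt a i) : h'.TableCorrect v := by
  intro A hA x₀ x₁ hx
  simp only [BitsMatch, hw 5 (by omega), hw 6 (by omega)] at hx
  rw [← htab A hA x₀ x₁ hx]
  simp only [outsideEntry, he 3 (by omega), he 4 (by omega), he 5 (by omega), he 6 (by omega)]

/-- One step of the table from the top down. Processors that write to the same cell write the same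
value, since it depends only on the vertex and the array. -/
theorem exec_tableStep (h : Holds D E R w q M) {i : ℕ} (hi : i ≤ R.rounds)
    (hreg : M.word (10 + D) 0 = i) (htab : ∀ v, i < R.round v → h.TableCorrect v) :
    ∃ M', Exec (tableStep D) M M' ((R.live i).card + 1) 1 ∧
      (∀ a i, M'.word a i = M.word a i) ∧
      ∃ h' : Holds D E R w q M', ∀ v, i ≤ R.round v → h'.TableCorrect v := by
  set V : WExp := .get 9 (.add (.get 8 (.get (10 + D) (.const 0))) .pid) with hV
  have hN : (WExp.get 7 (.get (10 + D) (.const 0))).eval M 0 = (R.live i).card := by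
    rw [WExp.eval, WExp.eval, WExp.eval, hreg, h.live_card i hi]
  obtain ⟨M', hstep⟩ := exists_step M (R.live i).card
    [.elt (.const 1) 3 V (outsideValueE D V (.const 0) (.const 0)),
     .elt (.const 1) 4 V (outsideValueE D V (.const 1) (.const 0)),
     .elt (.const 1) 5 V (outsideValueE D V (.const 0) (.const 1)),
     .elt (.const 1) 6 V (outsideValueE D V (.const 1) (.const 1))]
    (fun _ _ => 0) (fun a v => outsideValue D M v (if a = 4 ∨ a = 6 then 1 else 0)
      (if a = 5 ∨ a = 6 then 1 else 0))
    (by simp)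
    (by
      intro p _ g a addr val hmem
      simp only [List.mem_cons, Write.elt.injEq, List.not_mem_nil, or_false] at hmem
      rcases hmem with ⟨-, rfl, rfl, rfl⟩ | ⟨-, rfl, rfl, rfl⟩ | ⟨-, rfl, rfl, rfl⟩ |
        ⟨-, rfl, rfl, rfl⟩ <;> simp [eval_outsideValueE, WExp.eval])
  have hword : ∀ a i, M'.word a i = M.word a i := fun a =>
    hstep.word_eq_of_array fun g addr val hmem => by simp at hmem
  have helt : ∀ a < 2, ∀ i, M'.elt a i = M.elt a i := fun a ha =>
    hstep.elt_eq_of_array fun g addr val hmem => by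
      simp only [List.mem_cons, Write.elt.injEq, List.not_mem_nil, or_false] at hmem
      omega
  have h' : Holds D E R w q M' := h.of_agree (fun a _ => hword a) helt
  refine ⟨M', ?_, hword, h', fun v hv A hA x₀ x₁ hx => ?_⟩
  · have := Exec.par (N := .get 7 (.get (10 + D) (.const 0))) (hN ▸ hstep)
    rwa [hN] at this
  obtain ⟨p, hp, hpv⟩ := (h.live_list i hi).surjOn
    (show (v : ℕ) ∈ {x : ℕ | ∃ v ∈ R.live i, x = (v : ℕ)} from ⟨v, by simp [RCTree.live, hv], rfl⟩)
  have hVp : V.eval M p = v := by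
    simp only [hV, WExp.eval, hreg]
    exact hpv
  have hentry : ∀ a y₀ y₁, Write.elt (.const 1) a V (outsideValueE D V (.const y₀) (.const y₁)) ∈
      [Write.elt (.const 1) 3 V (outsideValueE D V (.const 0) (.const 0)),
       .elt (.const 1) 4 V (outsideValueE D V (.const 1) (.const 0)),
       .elt (.const 1) 5 V (outsideValueE D V (.const 0) (.const 1)),
       .elt (.const 1) 6 V (outsideValueE D V (.const 1) (.const 1))] →
      M'.elt a v = outsideValue D M v y₀ y₁ := fun a y₀ y₁ hmem =>
    hstep.elt_write p hp _ _ _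
      ⟨_, _, _, hmem, by simp [WExp.eval], hVp, by rw [eval_outsideValueE, hVp]; rfl⟩
  have hcorrect : ∀ y₀ y₁, (y₀ ≠ 0 ↔ x₀ ≠ 0) → (y₁ ≠ 0 ↔ x₁ ≠ 0) →
      outsideValue D M v y₀ y₁ = weightSum w (A \ {y | R.Below y (Sum.inl v)}) := by
    intro y₀ y₁ h₀ h₁
    refine h.outsideValue_eq (c := Sum.inl v) hA (fun b => ?_) fun u hu => htab u ?_
    · rw [h₀, h₁, ← hword, ← hword]
      exact hx b
    · exact lt_of_lt_of_le (Nat.lt_succ_of_le hv) hu.2.1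
  rw [outsideEntry]
  split_ifs with h₁ h₀ h₀
  · rw [hentry 6 1 1 (by simp), hcorrect] <;> simp [*]
  · rw [hentry 5 0 1 (by simp), hcorrect] <;> simp [*]
  · rw [hentry 4 1 0 (by simp), hcorrect] <;> simp [*]
  · rw [hentry 3 0 0 (by simp), hcorrect] <;> simp [*]

/-- In the memory `M`, query `j` is at the cluster `c`: the bits describe its subtree on the
boundary of `c`, and the partial sum is the weight of the part of the subtree inside `c`. -/
structure QueryAt (_ : Holds D E R w q M) (j : Fin k) (c : RCNode G) : Prop where
  node : M.word (11 + D) j = c.code E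
  cut : R.CutInside (subtree G (q j).1 (q j).2) c
  bits : BitsMatch E M (subtree G (q j).1 (q j).2) c (M.word (12 + D) j) (M.word (13 + D) j)
  inside : M.elt 2 j = weightSum w (subtree G (q j).1 (q j).2 ∩ {y | R.Below y c})

theorem exec_queryInit (h : Holds D E R w q M) (hG : G.IsAcyclic)
    (hq : ∀ j, G.Adj (q j).1 (q j).2) :
    ∃ M', Exec (queryInit D) M M' (k + 1) 1 ∧ (∀ a < 11 + D, ∀ i, M'.word a i = M.word a i) ∧
      (∀ a ≠ 2, ∀ i, M'.elt a i = M.elt a i) ∧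
      ∃ h' : Holds D E R w q M', ∀ j, ∃ c, h'.QueryAt j c := by
  obtain ⟨M', hexec, hnew, hword, helt⟩ := exec_updateQueries D k M h.card_queries
    (findEdgeE (.get 1 .pid) (.get 2 .pid) D)
    (.eqTest (.get 5 (findEdgeE (.get 1 .pid) (.get 2 .pid) D)) (.add (.get 1 .pid) (.const 1)))
    (.eqTest (.get 6 (findEdgeE (.get 1 .pid) (.get 2 .pid) D)) (.add (.get 1 .pid) (.const 1)))
    .empty
  have h' : Holds D E R w q M' :=
    h.of_agree (fun a ha => hword a (by omega)) fun a ha => helt a (by omega)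
  refine ⟨M', hexec, hword, helt, h', fun j => ?_⟩
  obtain ⟨h1, h2, h3, h4⟩ := hnew j j.2
  set e : G.edgeSet := ⟨s((q j).1, (q j).2), hq j⟩
  have he : (e : Sym2 (Fin n)) = s((q j).1, (q j).2) := rfl
  have hfind := h.findEdgeE_eq he j (.get 1 .pid) (.get 2 .pid) (h.query_root j)
    (h.query_parent j)
  simp only [WExp.eval_eqTest, WExp.eval, hfind, h.query_root] at h1 h2 h3
  have hp := parent_notMem_subtree hG (hq j)
  have hu : (Sum.inl (q j).1 : RCNode G) ∈ subtree G (q j).1 (q j).2 :=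
    SimpleGraph.Reachable.refl _
  have hend : ∀ b, b ∈ R.boundary (Sum.inr e) →
      (b = (q j).1 ↔ (Sum.inl b : RCNode G) ∈ subtree G (q j).1 (q j).2) := by
    intro b hb
    rw [R.mem_boundary_edge, he, Sym2.mem_iff] at hb
    rcases hb with rfl | rfl
    · simp [hu]
    · simp [hp, (hq j).ne']
  refine ⟨Sum.inr e, h1, cutInside_subtree R e he, fun b => ⟨fun hb => ?_, fun hb => ?_⟩, ?_⟩
  · rw [h2, ← hend b (h'.mem_boundary_of_slot two_pos hb), ← hword 5 (by omega), hb]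
    simp [Fin.ext_iff]
  · rw [h3, ← hend b (h'.mem_boundary_of_slot one_lt_two hb), ← hword 6 (by omega), hb]
    simp [Fin.ext_iff]
  · rw [h4, Set.eq_empty_of_forall_notMem (s := subtree G (q j).1 (q j).2 ∩ _),
      weightSum_empty]
    · rfl
    · rintro y ⟨hy, hye⟩
      rw [RCTree.below_edge_iff.1 hye] at hy
      exact hp (hy _ (Sym2.mem_mk_right _ _))

theorem exec_queryStep (h : Holds D E R w q M) {c : Fin k → RCNode G}
    (hc : ∀ j, h.QueryAt j (c j)) :
    ∃ M', Exec (queryStep D) M M' (k + 1) 1 ∧ (∀ a < 11 + D, ∀ i, M'.word a i = M.word a i) ∧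
      (∀ a ≠ 2, ∀ i, M'.elt a i = M.elt a i) ∧
      ∃ h' : Holds D E R w q M', ∀ j, ∃ c', h'.QueryAt j c' ∧
        (R.boundary c' = ∅ ∨
          R.boundary (c j) ≠ ∅ ∧ (c j).formed R.round < c'.formed R.round) := by
  obtain ⟨M', hexec, hnew, hword, helt⟩ := exec_updateQueries D k M h.card_queries
    (.ite (.get 4 (curE D)) (parentE (curE D)) (curE D))
    (.ite (.get 4 (curE D)) (parentBitE 0 (curE D) (bitE D 0) (bitE D 1)) (bitE D 0))
    (.ite (.get 4 (curE D)) (parentBitE 1 (curE D) (bitE D 0) (bitE D 1)) (bitE D 1))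
    (.add (.get 2 .pid) (.ite (.get 4 (curE D)) (gainE D (curE D) (bitE D 0) (bitE D 1)) .empty))
  have h' : Holds D E R w q M' :=
    h.of_agree (fun a ha => hword a (by omega)) fun a ha => helt a (by omega)
  have hbits : ∀ A c x₀ x₁, BitsMatch E M A c x₀ x₁ → BitsMatch E M' A c x₀ x₁ := by
    intro A c x₀ x₁ hx
    simpa only [BitsMatch, hword 5 (by omega), hword 6 (by omega)] using hx
  refine ⟨M', hexec, hword, helt, h', fun j => ?_⟩
  obtain ⟨h1, h2, h3, h4⟩ := hnew j j.2
  have hcur : (curE D).eval M j = (c j).code E := (hc j).node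
  have hb₀ : (bitE D 0).eval M j = M.word (12 + D) j := rfl
  have hb₁ : (bitE D 1).eval M j = M.word (13 + D) j := by
    simp only [bitE, WExp.eval]
    congr 1
    omega
  have hs : M.elt 2 ((WExp.pid).eval M j) = M.elt 2 j := rfl
  simp only [WExp.eval, EExp.eval, eval_parentE, eval_parentBitE, eval_gainE, hcur, hb₀, hb₁,
    (hc j).inside] at h1 h2 h3 h4
  rcases h.parent_cases (c j) with ⟨h0, hroot⟩ | ⟨v, hv, hv'⟩
  · simp only [h0, ne_eq, not_true_eq_false, if_false, add_zero] at h1 h2 h3 h4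
    refine ⟨c j, ⟨h1, (hc j).cut, hbits _ _ _ _ ?_, h4⟩, Or.inl hroot⟩
    rw [h2, h3]
    exact (hc j).bits
  · have hne : M.word 4 ((c j).code E) ≠ 0 := by omega
    rw [if_pos hne] at h1 h2 h3 h4
    refine ⟨Sum.inl v, ⟨?_, (hc j).cut.parent hv, hbits _ _ _ _ ?_, ?_⟩, 
      Or.inr ⟨Finset.ne_empty_of_mem hv.1, hv.formed_lt⟩⟩
    · rw [h1, hv']
      rfl
    · rw [h2, h3]
      exact h.bitsMatch_parent (hc j).cut hv (hc j).bits
    · rw [h4, h.inside_add_gain (hc j).cut hv (hc j).bits]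

theorem exec_queryFinish (h : Holds D E R w q M) {c : Fin k → RCNode G}
    (hc : ∀ j, h.QueryAt j (c j)) (htab : ∀ j v, R.IsChild (c j) v → h.TableCorrect v) :
    ∃ M', Exec (queryFinish D) M M' (k + 1) 1 ∧ Holds D E R w q M' ∧
      ∀ j : Fin k, M'.elt 2 j = weightSum w (subtree G (q j).1 (q j).2) := by
  obtain ⟨M', hexec, hnew, hword, helt⟩ := exec_updateQueries D k M h.card_queries
    (curE D) (bitE D 0) (bitE D 1)
    (.add (.get 2 .pid) (outsideValueE D (curE D) (bitE D 0) (bitE D 1)))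
  refine ⟨M', hexec, h.of_agree (fun a ha => hword a (by omega)) fun a ha => helt a (by omega),
    fun j => ?_⟩
  have hcur : (curE D).eval M j = (c j).code E := (hc j).node
  have hb₀ : (bitE D 0).eval M j = M.word (12 + D) j := rfl
  have hb₁ : (bitE D 1).eval M j = M.word (13 + D) j := by
    simp only [bitE, WExp.eval]
    congr 1
    omega
  rw [(hnew j j.2).2.2.2, EExp.eval, EExp.eval, WExp.eval, eval_outsideValueE, hcur, hb₀, hb₁,
    (hc j).inside, h.outsideValue_eq (hc j).cut (hc j).bits (htab j), ← weightSum_union,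
    Set.inter_union_sdiff]
  exact Set.disjoint_sdiff_inter.symm

/-- Work and span of a run, term by term. After `i₀` steps the cluster of a query is a root or is
formed in round `i₀` or later, so the table is correct at its parent. -/
theorem exec_queryProg (h : Holds D E R w q M) (hG : G.IsAcyclic)
    (hq : ∀ j, G.Adj (q j).1 (q j).2) {i₀ : ℕ} (hi₀ : i₀ ≤ R.rounds)
    (hlt : ∀ i < i₀, k < (R.live i).card) (hle : (R.live i₀).card ≤ k) :
    AnswersQueries D E R w q (queryProg D) M
      (3 * R.rounds + 3 + (3 * i₀ + 3 +
        (∑ s ∈ Finset.range (R.rounds - i₀), (2 + ((R.live (i₀ + s)).card + 1) + 1) + 1 +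
          (k + 1 + (∑ _s ∈ Finset.range i₀, (2 + (k + 1) + 1) + 1 + (k + 1))))))
      (2 * R.rounds + 2 + (2 * i₀ + 2 + ((R.rounds - i₀) * (1 + 1 + 1) + 1 +
        (1 + (i₀ * (1 + 1 + 1) + 1 + 1))))) := by
  -- The two searches.
  have run₁ := exec_searchProg D 0 R.rounds (.get 7 (.get (10 + D) (.const 0))) M (by
    intro s hs
    have hN := (h.setRegister 0 s).live_card s hs
    have hreg : (M.setWord (10 + D) 0 s).word (10 + D) 0 = s := by simp [Mem.setWord]
    simp only [WExp.eval, hreg, hN]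
    rw [← Nat.pos_iff_ne_zero, R.live_card_pos_iff])
  set M₁ := M.setWord (10 + D) 0 R.rounds with hM₁
  have h₁ : Holds D E R w q M₁ := h.setRegister 0 R.rounds
  have run₂ := exec_searchProg D 1 i₀
    (.sub (.get 7 (.get (10 + D) (.const 1))) (.get 0 (.const 1))) M₁ (by
    intro s hs
    have hN := (h₁.setRegister 1 s).live_card s (hs.trans hi₀)
    have hreg : (M₁.setWord (10 + D) 1 s).word (10 + D) 1 = s := by simp [Mem.setWord]
    simp only [WExp.eval, hreg, hN, (h₁.setRegister 1 s).card_queries]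
    constructor
    · intro hs'
      refine lt_of_le_of_ne hs ?_
      rintro rfl
      omega
    · intro hs'
      have := hlt s hs'
      omega)
  set M₂ := M₁.setWord (10 + D) 1 i₀ with hM₂
  have h₂ : Holds D E R w q M₂ := h₁.setRegister 1 i₀
  -- The table.
  obtain ⟨M₃, run₃, -, h₃, hreg₀, hreg₁, htab⟩ := exec_loop
    (c := .sub (.get (10 + D) (.const 0)) (.get (10 + D) (.const 1)))
    (P := .seq (decrease D 0) (tableStep D))
    (fun t M => i₀ + t ≤ R.rounds ∧ ∃ h : Holds D E R w q M, M.word (10 + D) 0 = i₀ + t ∧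
      M.word (10 + D) 1 = i₀ ∧ ∀ v, i₀ + t ≤ R.round v → h.TableCorrect v)
    (fun s => 2 + ((R.live (i₀ + s)).card + 1)) (1 + 1)
    (by
      rintro M ⟨-, h, hr₀, hr₁, -⟩
      simp [WExp.eval, hr₀, hr₁])
    (by
      rintro s M ⟨hs, h, hr₀, hr₁, htab⟩
      refine ⟨by simp [WExp.eval, hr₀, hr₁], ?_⟩
      have hdec := exec_assign M (10 + D) 0 (.sub (.get (10 + D) (.const 0)) (.const 1))
      have hval : (WExp.sub (.get (10 + D) (.const 0)) (.const 1)).eval M 0 = i₀ + s := by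
        simp only [WExp.eval, hr₀]
        omega
      rw [hval] at hdec
      obtain ⟨M', hexec, hword, h', htab'⟩ := (h.setRegister 0 (i₀ + s)).exec_tableStep
        (i := i₀ + s) (by omega) (by simp [Mem.setWord])
        (fun v hv => (htab v (by omega)).of_agree _
          (fun a ha _ => if_neg (by omega)) fun _ _ _ => rfl)
      refine ⟨M', Exec.seq hdec hexec, by omega, h', ?_, ?_, htab'⟩
      · rw [hword]
        simp [Mem.setWord]
      · rw [hword]
        simp [Mem.setWord, hr₁])
    (R.rounds - i₀) M₂ (by
      refine ⟨by omega, h₂, ?_, ?_, fun v hv => ?_⟩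
      · simp only [hM₂, hM₁, Mem.setWord]
        simp
        omega
      · simp [hM₂, Mem.setWord]
      · have : R.round v + 1 ≤ R.rounds :=
          Finset.le_sup (f := fun v => R.round v + 1) (Finset.mem_univ v)
        omega)
  -- The queries climb.
  obtain ⟨M₄, run₄, hword₄, helt₄, h₄, hq₄⟩ := h₃.exec_queryInit hG hq
  obtain ⟨M₅, run₅, h₅, -, htab₅, hq₅⟩ := exec_loop
    (c := .get (10 + D) (.const 1)) (P := .seq (decrease D 1) (queryStep D))
    (fun t M => ∃ h : Holds D E R w q M, M.word (10 + D) 1 = t ∧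
      (∀ v, i₀ ≤ R.round v → h.TableCorrect v) ∧
      ∀ j, ∃ c, h.QueryAt j c ∧ (R.boundary c = ∅ ∨ i₀ ≤ c.formed R.round + t))
    (fun _ => 2 + (k + 1)) (1 + 1)
    (by
      rintro M ⟨h, hr, -⟩
      simp [WExp.eval, hr])
    (by
      rintro s M ⟨h, hr, htab, hquery⟩
      refine ⟨by simp [WExp.eval, hr], ?_⟩
      have hdec := exec_assign M (10 + D) 1 (.sub (.get (10 + D) (.const 1)) (.const 1))
      have hval : (WExp.sub (.get (10 + D) (.const 1)) (.const 1)).eval M 0 = s := by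
        simp only [WExp.eval, hr]
        omega
      rw [hval] at hdec
      choose c hc hc' using hquery
      have hother : ∀ a ≠ 10 + D, ∀ i, (M.setWord (10 + D) 1 s).word a i = M.word a i :=
        fun a ha i => if_neg (by omega)
      obtain ⟨M', hexec, hword, helt, h', hquery'⟩ := (h.setRegister 1 s).exec_queryStep
        (c := c) (fun j => ⟨by rw [hother _ (by omega), (hc j).node], (hc j).cut, by
          simp only [BitsMatch, hother 5 (by omega), hother 6 (by omega),
            hother (12 + D) (by omega), hother (13 + D) (by omega)]
          exact (hc j).bits, (hc j).inside⟩)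
      refine ⟨M', Exec.seq hdec hexec, h', ?_, fun v hv => ?_, fun j => ?_⟩
      · rw [hword _ (by omega)]
        simp [Mem.setWord]
      · refine (htab v hv).of_agree h' (fun a ha i => ?_) fun a ha i => ?_
        · rw [hword a (by omega), hother a (by omega)]
        · rw [helt a ha]
          rfl
      · obtain ⟨c', hc₁, hc₂⟩ := hquery' j
        refine ⟨c', hc₁, hc₂.imp_right fun ⟨hne, hlt⟩ => ?_⟩
        have := (hc' j).resolve_left hne
        omega)
    i₀ M₄ (by
      refine ⟨h₄, by rw [hword₄ _ (by omega), hreg₁], fun v hv => ?_, fun j => ?_⟩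
      · exact (htab v (by omega)).of_agree h₄ (fun a ha => hword₄ a (by omega)) helt₄
      · obtain ⟨c, hc⟩ := hq₄ j
        exact ⟨c, hc, Or.inr (by omega)⟩)
  choose c hc hc' using hq₅
  obtain ⟨M₆, run₆, h₆, hans⟩ := h₅.exec_queryFinish hc (fun j v hv => htab₅ v (by
    rcases hc' j with hroot | hle
    · have := hv.1
      simp [hroot] at this
    · exact le_trans (by omega) hv.2.1))
  exact ⟨M₆, run₁.seq (run₂.seq (run₃.seq (run₄.seq (run₅.seq run₆)))), h₆, hans⟩

end Holds

/-! ### Work and span in terms of the numbers of live vertices -/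

namespace Holds

open PRAM

variable {D n m k : ℕ} {G : SimpleGraph (Fin n)} {S : Type*} [AddCommSemigroup S]
  {E : G.edgeSet ≃ Fin m} {R : RCTree G} {w : RCNode G → S} {q : Fin k → Fin n × Fin n}
  {M : Mem S}

/-- The climb costs `k` per round before round `i₀`, the table costs the number of live vertices per
round from then on; either is the minimum of the two numbers. -/
theorem exists_run_queryProg (h : Holds D E R w q M) (hG : G.IsAcyclic) (hk : 0 < k)
    (hq : ∀ j, G.Adj (q j).1 (q j).2) :
    ∃ W T, AnswersQueries D E R w q (queryProg D) M W T ∧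
      W ≤ 12 * (k + ∑ i ∈ Finset.range R.rounds, min k (R.live i).card) ∧
      T ≤ 8 * (R.rounds + 1) := by
  classical
  have hex : ∃ i, (R.live i).card ≤ k := by
    refine ⟨R.rounds, ?_⟩
    have := (R.live_card_pos_iff (i := R.rounds)).not.2 (lt_irrefl _)
    omega
  obtain ⟨i₀, hle, hmin⟩ : ∃ i₀, (R.live i₀).card ≤ k ∧ ∀ i < i₀, k < (R.live i).card :=
    ⟨Nat.find hex, Nat.find_spec hex, fun i hi => not_le.1 (Nat.find_min hex hi)⟩
  have hi₀ : i₀ ≤ R.rounds := by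
    by_contra hlt
    have h1 := hmin R.rounds (not_le.1 hlt)
    have := (R.live_card_pos_iff (i := R.rounds)).not.2 (lt_irrefl _)
    omega
  refine ⟨_, _, h.exec_queryProg hG hq hi₀ hmin hle, ?_, by omega⟩
  obtain ⟨a, ha⟩ := Nat.exists_eq_add_of_le hi₀
  have hsplit : ∑ i ∈ Finset.range R.rounds, min k (R.live i).card =
      i₀ * k + ∑ s ∈ Finset.range a, (R.live (i₀ + s)).card := by
    rw [ha, Finset.sum_range_add]
    congr 1
    · rw [Finset.sum_congr rfl fun i hi => min_eq_left (hmin i (Finset.mem_range.1 hi)).le]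
      simp
    · refine Finset.sum_congr rfl fun s _ => min_eq_right (le_trans (Finset.card_le_card ?_) hle)
      intro v hv
      simp only [RCTree.live, Finset.mem_filter, Finset.mem_univ, true_and] at hv ⊢
      omega
  have hpos : a ≤ ∑ s ∈ Finset.range a, (R.live (i₀ + s)).card := by
    have : ∑ s ∈ Finset.range a, 1 ≤ ∑ s ∈ Finset.range a, (R.live (i₀ + s)).card :=
      Finset.sum_le_sum fun s hs => R.live_card_pos_iff.2 (by
        have := Finset.mem_range.1 hs
        omega)
    simpa using this
  have hsub : R.rounds - i₀ = a := by omega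
  have hi₀k : i₀ ≤ i₀ * k := Nat.le_mul_of_pos_right _ hk
  rw [hsplit, hsub]
  simp only [Finset.sum_add_distrib, Finset.sum_const, Finset.card_range, smul_eq_mul]
  nlinarith

end Holds

/-! ### Expected numbers of live vertices -/

section Analysis

variable {Ω : Type*} (μ : PMF Ω)

theorem expect_le_pow_mul {L : Ω → ℕ → ℕ} {n : ℕ} {γ : ℝ≥0∞} (h0 : ∀ ω, L ω 0 ≤ n)
    (hL : ∀ i, ∑' ω, μ ω * (L ω (i + 1) : ℝ≥0∞) ≤ γ * ∑' ω, μ ω * (L ω i : ℝ≥0∞)) (i : ℕ) :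
    ∑' ω, μ ω * (L ω i : ℝ≥0∞) ≤ γ ^ i * n := by
  induction i with
  | zero =>
    calc ∑' ω, μ ω * (L ω 0 : ℝ≥0∞) ≤ ∑' ω, μ ω * (n : ℝ≥0∞) :=
          ENNReal.tsum_le_tsum fun ω => by gcongr; exact h0 ω
      _ = γ ^ 0 * n := by rw [ENNReal.tsum_mul_right, μ.tsum_coe, pow_zero]
  | succ i ih =>
    calc _ ≤ γ * ∑' ω, μ ω * (L ω i : ℝ≥0∞) := hL i
      _ ≤ γ * (γ ^ i * n) := by gcongr
      _ = γ ^ (i + 1) * n := by ring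

theorem expect_sum_min_le {L : Ω → ℕ → ℕ} {b : ℕ → ℝ≥0∞} {k : ℕ}
    (hL : ∀ i, ∑' ω, μ ω * (L ω i : ℝ≥0∞) ≤ b i) (r : Ω → ℕ) :
    ∑' ω, μ ω * ((∑ i ∈ Finset.range (r ω), min k (L ω i) : ℕ) : ℝ≥0∞) ≤
      ∑' i, min (k : ℝ≥0∞) (b i) := by
  calc _ ≤ ∑' ω, ∑' i, μ ω * ((min k (L ω i) : ℕ) : ℝ≥0∞) := by
        refine ENNReal.tsum_le_tsum fun ω => ?_
        rw [ENNReal.tsum_mul_left, Nat.cast_sum]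
        gcongr
        exact ENNReal.sum_le_tsum _
    _ = ∑' i, ∑' ω, μ ω * ((min k (L ω i) : ℕ) : ℝ≥0∞) := ENNReal.tsum_comm
    _ ≤ ∑' i, min (k : ℝ≥0∞) (b i) := by
        refine ENNReal.tsum_le_tsum fun i => le_min ?_ ((ENNReal.tsum_le_tsum fun ω => ?_).trans
          (hL i))
        · calc _ ≤ ∑' ω, μ ω * (k : ℝ≥0∞) :=
                ENNReal.tsum_le_tsum fun ω => by gcongr; exact min_le_left _ _
            _ = k := by rw [ENNReal.tsum_mul_right, μ.tsum_coe, one_mul]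
        · gcongr
          exact min_le_right _ _

theorem pow_ceil_le_exp_neg {γ : ℝ} (h0 : 0 < γ) (h1 : γ < 1) (x : ℝ) :
    γ ^ ⌈x / -Real.log γ⌉₊ ≤ Real.exp (-x) := by
  have hlog : 0 < -Real.log γ := by linarith [Real.log_neg h0 h1]
  rw [← Real.exp_log h0, ← Real.exp_nat_mul, Real.log_exp]
  refine Real.exp_le_exp.2 ?_
  have := (div_le_iff₀ hlog).1 (Nat.le_ceil (x / -Real.log γ))
  linarith

/-- The terms of the sum are bounded by `k` up to the index `t` at which the geometric sequence
drops below `k`, and by a geometric sequence starting from `k` after it. -/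
theorem tsum_min_pow_mul_le {γ : ℝ≥0} (h0 : 0 < γ) (h1 : γ < 1) {k : ℕ} (hk : 0 < k) (n : ℕ) :
    ∑' i, min (k : ℝ≥0∞) ((γ : ℝ≥0∞) ^ i * n) ≤
      ENNReal.ofReal (k * (1 + (1 - (γ : ℝ))⁻¹) +
        k * Real.log (1 + n / k) / -Real.log γ) := by
  have h0' : (0 : ℝ) < γ := h0
  have h1' : (γ : ℝ) < 1 := h1
  have hk' : (0 : ℝ) < k := Nat.cast_pos.2 hk
  have hlog : 0 < -Real.log γ := by linarith [Real.log_neg h0' h1']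
  have hn : (0 : ℝ) ≤ n / k := by positivity
  have hx : 0 ≤ Real.log (1 + n / k) := Real.log_nonneg (by linarith)
  set t := ⌈Real.log (1 + n / k) / -Real.log γ⌉₊ with ht
  have hpow : (γ : ℝ) ^ t * n ≤ k := by
    have h := pow_ceil_le_exp_neg h0' h1' (Real.log (1 + n / k))
    rw [Real.exp_neg, Real.exp_log (by linarith), ← ht] at h
    calc (γ : ℝ) ^ t * n ≤ (1 + n / k : ℝ)⁻¹ * n := by gcongr
      _ ≤ k := by
        rw [inv_mul_le_iff₀ (by linarith)]
        field_simp
        linarith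
  have hpow' : (γ : ℝ≥0∞) ^ t * n ≤ k := by
    have : γ ^ t * n ≤ k := by exact_mod_cast hpow
    exact_mod_cast this
  have hle : ∑' i, min (k : ℝ≥0∞) ((γ : ℝ≥0∞) ^ i * n) ≤ t * k + (1 - (γ : ℝ≥0∞))⁻¹ * k := by
    rw [← ENNReal.summable.sum_add_tsum_nat_add' (k := t), ← ENNReal.tsum_geometric,
      ← ENNReal.tsum_mul_right]
    gcongr with i
    · calc _ ≤ ∑ i ∈ Finset.range t, (k : ℝ≥0∞) := Finset.sum_le_sum fun i _ => min_le_left _ _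
        _ = t * k := by simp
    · calc _ ≤ (γ : ℝ≥0∞) ^ (i + t) * n := min_le_right _ _
        _ = (γ : ℝ≥0∞) ^ i * ((γ : ℝ≥0∞) ^ t * n) := by ring
        _ ≤ _ := by gcongr
  refine hle.trans ?_
  have hreal : (t : ℝ≥0∞) * k + (1 - (γ : ℝ≥0∞))⁻¹ * k =
      ENNReal.ofReal (t * k + (1 - (γ : ℝ))⁻¹ * k) := by
    rw [ENNReal.ofReal_add (by positivity) (by have : 0 < 1 - (γ : ℝ) := by linarith
                                               positivity),
      ENNReal.ofReal_mul (by positivity), ENNReal.ofReal_mul (by simp [h1'.le]),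
      ENNReal.ofReal_inv_of_pos (by linarith), ENNReal.ofReal_sub _ (by positivity)]
    simp
  rw [hreal]
  refine ENNReal.ofReal_le_ofReal ?_
  have hceil := (Nat.ceil_lt_add_one (div_nonneg hx hlog.le)).le
  rw [← ht] at hceil
  calc (t : ℝ) * k + (1 - (γ : ℝ))⁻¹ * k
      ≤ (Real.log (1 + n / k) / -Real.log γ + 1) * k + (1 - (γ : ℝ))⁻¹ * k := by gcongr
    _ = _ := by ring

/-- Many rounds are unlikely: by Markov's inequality some vertex is live after
`(a + 1) log n / log (1 / γ)` rounds with probability at most `n ^ (-a)`. -/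
theorem measure_rounds_le {L : Ω → ℕ → ℕ} {r : Ω → ℕ} {n : ℕ} (hn : 0 < n) {γ : ℝ≥0}
    (h0 : 0 < γ) (h1 : γ < 1) (hL : ∀ i, ∑' ω, μ ω * (L ω i : ℝ≥0∞) ≤ (γ : ℝ≥0∞) ^ i * n)
    (hr : ∀ ω, ∀ i < r ω, 0 < L ω i) (a : ℝ) :
    μ.toOuterMeasure {ω | ⌈(a + 1) * Real.log n / -Real.log γ⌉₊ < r ω} ≤
      ENNReal.ofReal ((n : ℝ) ^ (-a)) := by
  have hn' : (0 : ℝ) < n := Nat.cast_pos.2 hn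
  set t := ⌈(a + 1) * Real.log n / -Real.log γ⌉₊ with ht
  calc _ = ∑' ω, Set.indicator {ω | t < r ω} μ ω := PMF.toOuterMeasure_apply _ _
    _ ≤ ∑' ω, μ ω * (L ω t : ℝ≥0∞) := by
        refine ENNReal.tsum_le_tsum fun ω => ?_
        by_cases hω : t < r ω
        · have h : (1 : ℝ≥0∞) ≤ L ω t := by exact_mod_cast hr ω t hω
          rw [Set.indicator_of_mem (by exact hω)]
          calc μ ω = μ ω * 1 := (mul_one _).symm
            _ ≤ _ := by gcongr
        · rw [Set.indicator_of_notMem (by exact hω)]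
          exact zero_le
    _ ≤ (γ : ℝ≥0∞) ^ t * n := hL t
    _ = ENNReal.ofReal ((γ : ℝ) ^ t * n) := by
        rw [ENNReal.ofReal_mul (by positivity), ENNReal.ofReal_pow (by positivity)]
        simp
    _ ≤ _ := by
        refine ENNReal.ofReal_le_ofReal ?_
        calc (γ : ℝ) ^ t * n ≤ Real.exp (-((a + 1) * Real.log n)) * n := by
              gcongr
              exact pow_ceil_le_exp_neg h0 h1 _
          _ = Real.exp (-((a + 1) * Real.log n)) * Real.exp (Real.log n) := by
              rw [Real.exp_log hn']
          _ = (n : ℝ) ^ (-a) := by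
              rw [← Real.exp_add, Real.rpow_def_of_pos hn']
              congr 1
              ring

end Analysis

/-- A graph of maximum degree `D` has at most `D * n` pairs of adjacent vertices. -/
theorem card_queries_le {n k D : ℕ} {G : SimpleGraph (Fin n)} {q : Fin k → Fin n × Fin n}
    (hD : ∀ v, (G.neighborSet v).ncard ≤ D) (hq : ∀ j, G.Adj (q j).1 (q j).2)
    (hinj : Function.Injective q) : k ≤ D * n := by
  classical
  have hmem : ∀ j ∈ Finset.univ, (q j).1 ∈ (Finset.univ : Finset (Fin n)) := fun _ _ =>
    Finset.mem_univ _
  calc k = (Finset.univ : Finset (Fin k)).card := (Finset.card_fin k).symm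
    _ ≤ D * (Finset.univ : Finset (Fin n)).card := by
        refine Finset.card_le_mul_card_image_of_maps_to hmem D fun v _ => le_trans ?_ (hD v)
        rw [← Set.ncard_coe_finset]
        refine Set.ncard_le_ncard_of_injOn (fun j => (q j).2) ?_ ?_ (Set.toFinite _)
        · intro j hj
          have hj' : (q j).1 = v := by simpa using hj
          exact hj' ▸ hq j
        · intro j hj j' hj' heq
          have h1 : (q j).1 = v := by simpa using hj
          have h2 : (q j').1 = v := by simpa using hj'
          exact hinj (Prod.ext (h1.trans h2.symm) heq)
    _ = D * n := by rw [Finset.card_fin]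

/-! ### The bounds for balanced RC-trees -/

theorem two_le_of_adj {n : ℕ} {G : SimpleGraph (Fin n)} {u p : Fin n} (h : G.Adj u p) : 2 ≤ n := by
  by_contra hlt
  exact h.ne (Fin.ext (by omega))

/-- The bounds for randomized RC-trees, with a constant that depends only on `D` and `β`. -/
theorem exists_bounds_randomized (D : ℕ) (β : ℝ≥0) (hβ : β < 1) : ∃ C : ℝ, 0 < C ∧
    ∀ (S : Type*) [AddCommSemigroup S] (n m k : ℕ) (G : SimpleGraph (Fin n))
      (E : G.edgeSet ≃ Fin m) (w : RCNode G → S) (q : Fin k → Fin n × Fin n),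
      G.IsAcyclic → (∀ v, (G.neighborSet v).ncard ≤ D) →
      0 < k → (∀ j, G.Adj (q j).1 (q j).2) →
      ∀ (Ω : Type*) (μ : PMF Ω) (R : Ω → RCTree G) (M : Ω → PRAM.Mem S),
        (∀ i, ∑' ω, μ ω * ((R ω).live (i + 1)).card ≤
          (β : ℝ≥0∞) * ∑' ω, μ ω * ((R ω).live i).card) →
        (∀ ω, Holds D E (R ω) w q (M ω)) →
        ∃ W T : Ω → ℕ,
          (∀ ω, AnswersQueries D E (R ω) w q (PRAM.queryProg D) (M ω) (W ω) (T ω)) ∧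
          ∑' ω, μ ω * (W ω : ℝ≥0∞) ≤
            ENNReal.ofReal (C * (k + k * Real.log (1 + n / k))) ∧
          (Function.Injective q → ∑' ω, μ ω * (W ω : ℝ≥0∞) ≤
            ENNReal.ofReal (C * (k * Real.log (1 + n / k)))) ∧
          ∀ a : ℝ, 0 < a →
            μ.toOuterMeasure {ω | C * (a + 1) * Real.log n < T ω} ≤
              ENNReal.ofReal ((n : ℝ) ^ (-a)) := by
  -- Enlarging `β` to a positive number makes its logarithm meaningful.
  set γ : ℝ≥0 := max β (1 / 2) with hγ
  have h0 : 0 < γ := lt_max_of_lt_right (by norm_num)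
  have h1 : γ < 1 := max_lt hβ (by rw [div_lt_one] <;> norm_num)
  have h0' : (0 : ℝ) < γ := h0
  have h1' : (γ : ℝ) < 1 := h1
  have hlog : 0 < -Real.log γ := by linarith [Real.log_neg h0' h1']
  set A : ℝ := 12 * (2 + (1 - (γ : ℝ))⁻¹ + (-Real.log γ)⁻¹) with hA
  have hApos : 0 < A := by
    have : 0 < 1 - (γ : ℝ) := by linarith
    positivity
  -- For distinct queries `k ≤ D * n`, so that `log (1 + n / k)` is at least `B`.
  set B : ℝ := Real.log (1 + 1 / (D + 1)) with hB
  have hBpos : 0 < B := Real.log_pos (lt_add_of_pos_right _ (by positivity))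
  set A' : ℝ := 8 * (2 / Real.log 2 + (-Real.log γ)⁻¹) with hA'
  have hlog2 : 0 < Real.log 2 := Real.log_pos one_lt_two
  have hA'pos : 0 < A' := by positivity
  refine ⟨A * (1 + B⁻¹) + A', by positivity, ?_⟩
  intro S _ n m k G E w q hG hD hk hq Ω μ R M hbal hM
  choose W T hans hW hT using fun ω => (hM ω).exists_run_queryProg hG hk hq
  have hk' : (0 : ℝ) < k := Nat.cast_pos.2 hk
  have hx : 0 ≤ Real.log (1 + n / k) :=
    Real.log_nonneg (le_add_of_nonneg_right (by positivity))
  have hL : ∀ i, ∑' ω, μ ω * (((R ω).live i).card : ℝ≥0∞) ≤ (γ : ℝ≥0∞) ^ i * n :=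
    expect_le_pow_mul μ (L := fun ω i => ((R ω).live i).card)
      (fun ω => (Finset.card_le_univ _).trans_eq (Fintype.card_fin n))
      fun i => (hbal i).trans (by gcongr; exact le_max_left _ _)
  have hexp : ∑' ω, μ ω * (W ω : ℝ≥0∞) ≤
      ENNReal.ofReal (A * (k + k * Real.log (1 + n / k))) := by
    set s : Ω → ℕ := fun ω => ∑ i ∈ Finset.range (R ω).rounds, min k ((R ω).live i).card
    calc _ ≤ ∑' ω, μ ω * ((12 * (k + s ω) : ℕ) : ℝ≥0∞) :=
          ENNReal.tsum_le_tsum fun ω => by gcongr; exact hW ω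
      _ = ∑' ω, (μ ω * (12 * k) + 12 * (μ ω * s ω)) :=
          tsum_congr fun ω => by push_cast; ring
      _ = 12 * k + 12 * ∑' ω, μ ω * (s ω : ℝ≥0∞) := by
          rw [ENNReal.tsum_add, ENNReal.tsum_mul_right, μ.tsum_coe, one_mul,
            ENNReal.tsum_mul_left]
      _ ≤ 12 * k + 12 * ENNReal.ofReal (k * (1 + (1 - (γ : ℝ))⁻¹) +
            k * Real.log (1 + n / k) / -Real.log γ) := by
          gcongr
          exact (expect_sum_min_le μ hL _).trans (tsum_min_pow_mul_le h0 h1 hk n)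
      _ = ENNReal.ofReal (12 * k + 12 * (k * (1 + (1 - (γ : ℝ))⁻¹) +
            k * Real.log (1 + n / k) / -Real.log γ)) := by
          have : 0 < 1 - (γ : ℝ) := by linarith
          rw [ENNReal.ofReal_add (p := 12 * k) (by positivity) (by positivity),
            ENNReal.ofReal_mul (p := 12) (by positivity),
            ENNReal.ofReal_mul (p := 12) (by positivity)]
          simp
      _ ≤ _ := by
          refine ENNReal.ofReal_le_ofReal ?_
          have hd : 0 < (1 - (γ : ℝ))⁻¹ := inv_pos.2 (by linarith)
          have hl : 0 < (-Real.log γ)⁻¹ := inv_pos.2 hlog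
          have e1 : 0 ≤ k * Real.log (1 + n / k) := by positivity
          rw [hA, div_eq_mul_inv]
          nlinarith [mul_nonneg e1 hd.le, mul_nonneg hk'.le hl.le]
  refine ⟨W, T, hans, hexp.trans (ENNReal.ofReal_le_ofReal ?_),
    fun hinj => hexp.trans (ENNReal.ofReal_le_ofReal ?_), fun a ha => le_trans ?_
      (measure_rounds_le μ (L := fun ω i => ((R ω).live i).card) (r := fun ω => (R ω).rounds)
        (q ⟨0, hk⟩).1.pos h0 h1 hL (fun ω i hi => (R ω).live_card_pos_iff.2 hi) a)⟩
  · have : 0 ≤ A * B⁻¹ := by positivity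
    gcongr
    linarith
  · have hle : (k : ℝ) ≤ D * n := by exact_mod_cast card_queries_le hD hq hinj
    have hfrac : (1 : ℝ) / (D + 1) ≤ n / k := by
      rw [div_le_div_iff₀ (by positivity) hk']
      have : (0 : ℝ) ≤ n := by positivity
      linarith
    have hBle : B ≤ Real.log (1 + n / k) := by
      rw [hB]
      gcongr
    have hk1 : (k : ℝ) ≤ k * Real.log (1 + n / k) * B⁻¹ := by
      rw [← div_eq_mul_inv, le_div_iff₀ hBpos]
      gcongr
    calc A * (k + k * Real.log (1 + n / k))
        ≤ A * (k * Real.log (1 + n / k) * B⁻¹ + k * Real.log (1 + n / k)) := by gcongr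
      _ = A * (1 + B⁻¹) * (k * Real.log (1 + n / k)) := by ring
      _ ≤ _ := by
        gcongr
        linarith
  · refine MeasureTheory.measure_mono (fun ω hω => ?_)
    have hn : 2 ≤ n := two_le_of_adj (hq ⟨0, hk⟩)
    have hlogn : Real.log 2 ≤ Real.log n := Real.log_le_log two_pos (by exact_mod_cast hn)
    by_contra hr
    have hr' : (R ω).rounds ≤ ⌈(a + 1) * Real.log n / -Real.log γ⌉₊ := not_lt.1 hr
    have hpos : 0 ≤ (a + 1) * Real.log n := by
      have : 0 < Real.log n := hlog2.trans_le hlogn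
      positivity
    have hceil := (Nat.ceil_lt_add_one (div_nonneg hpos hlog.le)).le
    have hTω : (T ω : ℝ) ≤ 8 * ((R ω).rounds + 1) := by exact_mod_cast hT ω
    have hr'' : ((R ω).rounds : ℝ) ≤ (a + 1) * Real.log n / -Real.log γ + 1 :=
      le_trans (by exact_mod_cast hr') hceil
    have h2 : 2 ≤ 2 / Real.log 2 * ((a + 1) * Real.log n) := by
      rw [div_mul_eq_mul_div, le_div_iff₀ hlog2]
      nlinarith
    have hω' : (A * (1 + B⁻¹) + A') * (a + 1) * Real.log n < T ω := hω
    have hA'' : A' * ((a + 1) * Real.log n) =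
        8 * (2 / Real.log 2 * ((a + 1) * Real.log n) +
          (a + 1) * Real.log n / -Real.log γ) := by
      rw [hA', div_eq_mul_inv _ (-Real.log γ)]
      ring
    have h3 : 0 ≤ A * (1 + B⁻¹) * ((a + 1) * Real.log n) := mul_nonneg (by positivity) hpos
    linarith

/-- The deterministic bounds are those for a distribution with a single outcome. -/
theorem mainTheorem3 (D : ℕ) :
    ∃ P : PRAM.Prog, ∀ β : ℝ≥0, β < 1 → ∃ C : ℝ, 0 < C ∧
      ∀ (S : Type*) [AddCommSemigroup S] (n m k : ℕ) (G : SimpleGraph (Fin n))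
        (E : G.edgeSet ≃ Fin m) (w : RCNode G → S) (q : Fin k → Fin n × Fin n),
        G.IsAcyclic → (∀ v, (G.neighborSet v).ncard ≤ D) →
        0 < k → (∀ j, G.Adj (q j).1 (q j).2) →
        -- deterministically balanced RC-trees
        (∀ (R : RCTree G) (M : PRAM.Mem S),
          (∀ i, ((R.live (i + 1)).card : ℝ≥0) ≤ β * (R.live i).card) →
          Holds D E R w q M →
          ∃ W T : ℕ, AnswersQueries D E R w q P M W T ∧
            (W : ℝ) ≤ C * (k + k * Real.log (1 + n / k)) ∧
            (Function.Injective q → (W : ℝ) ≤ C * (k * Real.log (1 + n / k))) ∧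
            (T : ℝ) ≤ C * Real.log n) ∧
        -- randomized RC-trees, balanced in expectation
        (∀ (Ω : Type*) (μ : PMF Ω) (R : Ω → RCTree G) (M : Ω → PRAM.Mem S),
          (∀ i, ∑' ω, μ ω * ((R ω).live (i + 1)).card ≤
            (β : ℝ≥0∞) * ∑' ω, μ ω * ((R ω).live i).card) →
          (∀ ω, Holds D E (R ω) w q (M ω)) →
          ∃ W T : Ω → ℕ, (∀ ω, AnswersQueries D E (R ω) w q P (M ω) (W ω) (T ω)) ∧
            ∑' ω, μ ω * (W ω : ℝ≥0∞) ≤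
              ENNReal.ofReal (C * (k + k * Real.log (1 + n / k))) ∧
            (Function.Injective q → ∑' ω, μ ω * (W ω : ℝ≥0∞) ≤
              ENNReal.ofReal (C * (k * Real.log (1 + n / k)))) ∧
            ∀ a : ℝ, 0 < a →
              μ.toOuterMeasure {ω | C * (a + 1) * Real.log n < T ω} ≤
                ENNReal.ofReal ((n : ℝ) ^ (-a))) := by
  refine ⟨PRAM.queryProg D, fun β hβ => ?_⟩
  obtain ⟨C₁, hC₁, hrand⟩ := exists_bounds_randomized D β hβ
  have hmono : ∀ {x : ℝ}, 0 ≤ x → C₁ * x ≤ 2 * C₁ * x := fun hx => by nlinarith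
  refine ⟨2 * C₁, by positivity, fun S _ n m k G E w q hG hD hk hq => ?_⟩
  have hx : 0 ≤ Real.log (1 + n / k) :=
    Real.log_nonneg (le_add_of_nonneg_right (by positivity))
  have hx₁ : 0 ≤ k * Real.log (1 + n / k) := by positivity
  have hx₂ : 0 ≤ k + k * Real.log (1 + n / k) := by positivity
  have hn : 2 ≤ n := two_le_of_adj (hq ⟨0, hk⟩)
  have hn' : (1 : ℝ) < n := by exact_mod_cast hn
  have hlogn : 0 < Real.log n := Real.log_pos hn'
  constructor
  -- The tail bound with `a = 1` is less than `1`, so the span of the only outcome is in bounds.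
  · intro R M hbal hM
    obtain ⟨W, T, hans, hW, hW', hT⟩ := hrand S n m k G E w q hG hD hk hq PUnit
      (PMF.pure PUnit.unit)
      (fun _ => R) (fun _ => M)
      (fun i => by simpa using (by exact_mod_cast hbal i :
        ((R.live (i + 1)).card : ℝ≥0∞) ≤ β * (R.live i).card))
      (fun _ => hM)
    simp only [tsum_fintype, Finset.univ_unique, PUnit.default_eq_unit, Finset.sum_singleton,
      PMF.pure_apply, if_true, one_mul] at hW hW'
    rw [← ENNReal.ofReal_natCast] at hW hW'
    refine ⟨W PUnit.unit, T PUnit.unit, hans _, ?_, fun hinj => ?_, ?_⟩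
    · exact ((ENNReal.ofReal_le_ofReal_iff (by positivity)).1 hW).trans (hmono hx₂)
    · exact ((ENNReal.ofReal_le_ofReal_iff (by positivity)).1 (hW' hinj)).trans (hmono hx₁)
    · by_contra hlt
      have h := hT 1 one_pos
      rw [PMF.toOuterMeasure_pure_apply, if_pos] at h
      · have hlt1 : (n : ℝ) ^ (-1 : ℝ) < 1 := Real.rpow_lt_one_of_one_lt_of_neg hn' (by norm_num)
        rw [ENNReal.one_le_ofReal] at h
        linarith
      · show C₁ * (1 + 1) * Real.log n < T PUnit.unit
        linarith
  · intro Ω μ R M hbal hM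
    obtain ⟨W, T, hans, hW, hW', hT⟩ := hrand S n m k G E w q hG hD hk hq Ω μ R M hbal hM
    refine ⟨W, T, hans, hW.trans (ENNReal.ofReal_le_ofReal (hmono hx₂)),
      fun hinj => (hW' hinj).trans (ENNReal.ofReal_le_ofReal (hmono hx₁)), fun a ha => le_trans
        (MeasureTheory.measure_mono fun ω hω => ?_) (hT a ha)⟩
    have h0 : 0 ≤ (a + 1) * Real.log n := by positivity
    have hω' : 2 * C₁ * (a + 1) * Real.log n < T ω := hω
    show C₁ * (a + 1) * Real.log n < T ω
    nlinarith
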